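/- Let $V$ be a real vector space of dimension $6$, let $L=(\Lambda^6V)^{1/2}$ be a real line with a fixed isomorphism $L\otimes L\cong\Lambda^6V$, and let $S=\Lambda^{ev}V^*\otimes L$. Give $V\oplus V^*$ the inner product $(v+\xi,v+\xi)=-\langle v,\xi\rangle$, and let $v+\xi$ act on $\Lambda^*V^*\otimes L$ by $(v+\xi)\cdot\psi=\iota(v)\psi+\xi\wedge\psi$. Let $\sigma$ be the resulting spin representation of $\mathfrak{so}(V\oplus V^*)$ on $S$. On $S$ consider the bilinear form $$\langle\psi,\chi\rangle=\sum_m(-1)^m\psi_{2m}\wedge\chi_{6-2m}\in\Lambda^6V^*\otimes L^2=\mathbf R .$$ The moment map $\mu:S\to\mathfrak{so}(V\oplus V^*)$ is defined by $\operatorname{tr}(\mu(\rho)a)=\tfrac12\langle\sigma(a)\rho,\rho\rangle$ for all $a\in\mathfrak{so}(V\oplus V^*)$, with traces taken on $V\oplus V^*$. Put $$q(\rho)=4\operatorname{tr}\mu(\rho)^2,\qquad U=\{\rho\in S: q(\rho)<0\},\qquad \phi(\rho)=\sqrt{-q(\rho)/3}\quad(\rho\in U).$$ A spinor $\varphi\in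 S\otimes\mathbf C$ is called pure if its annihilator in $(V\oplus V^*)\otimes\mathbf C$ has complex dimension $6$. Then $\langle\cdot,\cdot\rangle$ is a symplectic form on $S$, the set $U$ is open, and for each $\rho\in U$ there is exactly one pure spinor $\varphi$ with $\rho=\varphi+\bar\varphi$ and $\langle\varphi,\bar\varphi\rangle=i\phi(\rho)$. Define $\hat\rho\in S$ by $\rho+i\hat\rho=2\varphi$. The function $\phi$ is differentiable on $U$ and has a Hamiltonian vector field $X:U\to S$, that is, $\langle X(\rho),\dot\rho\rangle=d\phi_\rho(\dot\rho)$ for all $\rho\in U$ and $\dot\rho\in S$. Moreover: 1. $X(\rho)=\hat\rho$ for all $\rho\in U$. 2. $X$ generates the circle action $\varphi\mapsto e^{-i\theta}\varphi$ on $U$: if $\varphi$ is the pure spinor of $\rho\in U$, then for each $\theta\in\mathbf R$ there is a point $\rho_\theta\in U$ whose pure spinor is $e^{-i\theta}\varphi$, and $\frac{d}{d\theta}\rho_\theta=X(\rho_\theta)$. 3. $X$ is smooth on $U$, and its derivative $J=DX:U\to\operatorname{End}S$ is an integrable almost complex structure on $U$: $J$ is smooth, $J_\rho^2=-1$ for each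 $\rho\in U$, and near each point of $U$ there are smooth coordinates with values in $\mathbf C^n$ whose differential takes $J$ to multiplication by $i$. -/

import Mathlib

open scoped TensorProduct ContDiff

noncomputable section

namespace SpinSix

/-! ### The inner product space `V ⊕ V*` and its orthogonal Lie algebra -/

section Orthogonal

variable (V : Type*) [AddCommGroup V] [Module ℝ V]

/-- A shortcut for the usual additive group structure on the dual space, for instance search. -/
instance : AddCommGroup (Module.Dual ℝ V) := LinearMap.addCommGroup

/-- The vector space `V ⊕ V*`. -/
abbrev Gen : Type _ := V × Module.Dual ℝ V

/-- The polarization of the inner product `(v + ξ, v + ξ) = -⟨v, ξ⟩` on `V ⊕ V*`, that is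
`(v + ξ, w + η) = -(ξ(w) + η(v)) / 2`. -/
def metric : LinearMap.BilinForm ℝ (Gen V) :=
  LinearMap.mk₂ ℝ (fun x y : Gen V => -(1 / 2 : ℝ) * (x.2 y.1 + y.2 x.1))
    (fun x x' y => by simp; ring) (fun c x y => by simp; ring)
    (fun x y y' => by simp; ring) (fun c x y => by simp; ring)

/-- The Lie algebra `𝔰𝔬(V ⊕ V*)`: the endomorphisms that are skew for the inner product. -/
abbrev So : Submodule ℝ (Module.End ℝ (Gen V)) := (metric V).skewAdjointSubmodule

/-- The inner product `tr(XY)` on `𝔰𝔬(V ⊕ V*)`. -/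
def traceForm : LinearMap.BilinForm ℝ (So V) :=
  LinearMap.mk₂ ℝ (fun X Y : So V =>
      LinearMap.trace ℝ (Gen V) ((X : Module.End ℝ (Gen V)) * (Y : Module.End ℝ (Gen V))))
    (fun X X' Y => by simp [add_mul]) (fun c X Y => by simp)
    (fun X Y Y' => by simp [mul_add]) (fun c X Y => by simp)

variable [FiniteDimensional ℝ V]

theorem traceForm_nondegenerate : (traceForm V).Nondegenerate := by
  have hsymm : ∀ x y : Gen V, metric V x y = metric V y x := by
    intro x y; simp [metric]; ring
  have key : ∀ a : So V, (∀ b : So V, traceForm V a b = 0) → a = 0 := by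
    intro a ha
    have hskew : ∀ x y : Gen V,
        metric V ((a : Module.End ℝ (Gen V)) x) y
          = -metric V x ((a : Module.End ℝ (Gen V)) y) := by
      intro x y
      have h := LinearMap.mem_skewAdjointSubmodule _ |>.1 a.2 x y
      simpa using h
    have hzero : ∀ x y : Gen V, metric V x ((a : Module.End ℝ (Gen V)) y) = 0 := by
      intro x y
      let b : Module.End ℝ (Gen V) := (metric V x).smulRight y - (metric V y).smulRight x
      have hb : b ∈ So V := by
        refine (LinearMap.mem_skewAdjointSubmodule _).2 fun z w => ?_
        simp [b, hsymm z]
        ring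
      have h := ha ⟨b, hb⟩
      have e1 : ∀ (f : Module.Dual ℝ (Gen V)) (z : Gen V),
          (a : Module.End ℝ (Gen V)) * f.smulRight z
            = f.smulRight ((a : Module.End ℝ (Gen V)) z) := by
        intro f z; apply LinearMap.ext; intro w
        simp only [Module.End.mul_apply, LinearMap.smulRight_apply, map_smul]
      have h2 : metric V x ((a : Module.End ℝ (Gen V)) y)
          - metric V y ((a : Module.End ℝ (Gen V)) x) = 0 := by
        simpa [traceForm, b, mul_sub, e1, LinearMap.trace_smulRight] using h
      have h3 := hskew y x
      have h4 := hsymm ((a : Module.End ℝ (Gen V)) y) x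
      have h5 := hskew x y
      have h6 := hsymm ((a : Module.End ℝ (Gen V)) x) y
      linarith
    ext1
    apply LinearMap.ext
    intro y
    refine Prod.ext ?_ ?_
    · refine (Module.forall_dual_apply_eq_zero_iff ℝ _).1 fun f => ?_
      simpa [metric] using hzero (0, f) y
    · refine LinearMap.ext fun v => ?_
      simpa [metric] using hzero (v, 0) y
  refine ⟨key, fun a ha => key a fun b => ?_⟩
  have h := ha b
  simp only [traceForm, LinearMap.mk₂_apply] at h ⊢
  rw [LinearMap.trace_mul_comm]
  exact h

end Orthogonal

/-! ### Spinors -/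

section Spinors

variable (V L : Type*) [AddCommGroup V] [Module ℝ V] [AddCommGroup L] [Module ℝ L]

/-- The exterior algebra `Λ*V*`. -/
abbrev Forms : Type _ := ExteriorAlgebra ℝ (Module.Dual ℝ V)

/-- The Clifford action `(v + ξ) · φ = ι(v)φ + ξ ∧ φ` of `V ⊕ V*` on `Λ*V*`. -/
def clifford : Gen V →ₗ[ℝ] Module.End ℝ (Forms V) :=
  LinearMap.coprod
    (CliffordAlgebra.contractLeft (Q := (0 : QuadraticForm ℝ (Module.Dual ℝ V)))
      ∘ₗ Module.Dual.eval ℝ V)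
    (LinearMap.mul ℝ (Forms V) ∘ₗ ExteriorAlgebra.ι ℝ)

/-- `Λ*V* ⊗ L`, written with the line `L` on the left. Below, `L` is a square root of `Λ⁶V`. -/
abbrev TwForms : Type _ := L ⊗[ℝ] Forms V

/-- The Clifford action of `V ⊕ V*` on `Λ*V* ⊗ L`. -/
def twClifford : Gen V →ₗ[ℝ] Module.End ℝ (TwForms V L) :=
  LinearMap.lTensorHom L ∘ₗ clifford V

theorem commutator_aux {R : Type*} [Ring R] [Algebra ℝ R] (p v x : R) (s t : ℝ)
    (h1 : v * x + x * v = s • (1 : R)) (h2 : p * x + x * p = -t • (1 : R)) :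
    p * v * x - x * (p * v) = s • p + t • v := by
  have e : p * v * x - x * (p * v) = p * (v * x + x * v) - (p * x + x * p) * v := by noncomm_ring
  rw [e, h1, h2]
  simp

theorem half_commutator_aux {R : Type*} [Ring R] [Algebra ℝ R] (S x T : R)
    (h : S * x - x * S = T + T) : ((1 / 2 : ℝ) • S) * x - x * ((1 / 2 : ℝ) • S) = T := by
  rw [smul_mul_assoc, mul_smul_comm, ← smul_sub, h, ← two_smul ℝ, smul_smul]
  norm_num

theorem twClifford_anticomm (x y : Gen V) :
    twClifford V L x * twClifford V L y + twClifford V L y * twClifford V L x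
      = (x.2 y.1 + y.2 x.1) • (1 : Module.End ℝ (TwForms V L)) := by
  have h : clifford V x * clifford V y + clifford V y * clifford V x
      = (x.2 y.1 + y.2 x.1) • (1 : Module.End ℝ (Forms V)) := by
    apply LinearMap.ext
    intro φ
    have h0 := congrArg (· * φ) (ExteriorAlgebra.ι_add_mul_swap (R := ℝ) x.2 y.2)
    have h1 := CliffordAlgebra.contractLeft_comm (Q := (0 : QuadraticForm ℝ (Module.Dual ℝ V)))
      (Module.Dual.eval ℝ V x.1) (Module.Dual.eval ℝ V y.1) φ
    simp only [add_mul, mul_assoc, zero_mul] at h0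
    simp only [clifford, LinearMap.add_apply, Module.End.mul_apply, LinearMap.coprod_apply,
      LinearMap.comp_apply, LinearMap.mul_apply', mul_add, LinearMap.smul_apply,
      Module.End.one_apply, add_smul]
    rw [h1]
    erw [CliffordAlgebra.contractLeft_ι_mul, CliffordAlgebra.contractLeft_ι_mul]
    simp only [Module.Dual.eval_apply]
    rw [eq_neg_of_add_eq_zero_left h0]
    abel
  have h2 := congrArg (LinearMap.lTensorHom (R := ℝ) L) h
  simpa [twClifford, LinearMap.lTensor_mul, Module.End.one_eq_id] using h2

/-- The subspace `S = Λ^{ev}V* ⊗ L` of `Λ*V* ⊗ L`. -/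
def spinorSubmodule : Submodule ℝ (TwForms V L) :=
  LinearMap.range
    (LinearMap.lTensor L
      (CliffordAlgebra.evenOdd (0 : QuadraticForm ℝ (Module.Dual ℝ V)) 0).subtype)

/-- The spinor space `S = S⁺ = Λ^{ev}V* ⊗ L`. -/
abbrev Spinor : Type _ := ↥(spinorSubmodule V L)

/-- The natural pairing of the degree six part of a form with `Λ⁶V`. -/
def topPairing : Forms V →ₗ[ℝ] Module.Dual ℝ (⋀[ℝ]^6 V) :=
  exteriorPower.pairingDual ℝ V 6
    ∘ₗ DirectSum.component ℝ ℕ (fun i => ⋀[ℝ]^i (Module.Dual ℝ V)) 6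
    ∘ₗ (DirectSum.decomposeLinearEquiv (fun i => ⋀[ℝ]^i (Module.Dual ℝ V))).toLinearMap

/-- `(α, β) ↦ σ(α) ∧ β`, where `σ` is the anti-automorphism reversing products of one-forms.
It acts on forms of degree `p` as `(-1)^{p(p-1)/2}`, i.e. as `(-1)^m` for `p = 2m, 2m + 1`. -/
def sigmaWedge : LinearMap.BilinMap ℝ (Forms V) (Forms V) :=
  LinearMap.mul ℝ (Forms V) ∘ₗ
    CliffordAlgebra.reverse (Q := (0 : QuadraticForm ℝ (Module.Dual ℝ V)))

variable {V L}

/-- The bilinear form `⟨φ, ψ⟩ = (σφ ∧ ψ)₆ ∈ Λ⁶V* ⊗ L ⊗ L = Λ⁶V* ⊗ Λ⁶V = ℝ`, for a given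
identification `sq : L ⊗ L ≅ Λ⁶V`. -/
def twForm (sq : L ⊗[ℝ] L ≃ₗ[ℝ] ⋀[ℝ]^6 V) : LinearMap.BilinForm ℝ (TwForms V L) :=
  (LinearMap.BilinMap.tmul ((TensorProduct.mk ℝ L L).compr₂ sq.toLinearMap)
    (sigmaWedge V)).compr₂ (TensorProduct.lift (topPairing V).flip)

/-- The bilinear form `⟨φ, ψ⟩` on the spinor space `S`. -/
def spinForm (sq : L ⊗[ℝ] L ≃ₗ[ℝ] ⋀[ℝ]^6 V) : LinearMap.BilinForm ℝ (Spinor V L) :=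
  (twForm sq).domRestrict₁₂ (spinorSubmodule V L) (spinorSubmodule V L)

variable [FiniteDimensional ℝ V]

variable (V L) in
/-- The spin representation `σ` of `𝔰𝔬(V ⊕ V*)`. For a basis `e_i` of `V` with dual basis `e^i`,
`σ(a) = ½ ∑ᵢ (c(a e_i) c(e^i) + c(a e^i) c(e_i))`, where `c` is the Clifford action. -/
def spinRep : So V →ₗ[ℝ] Module.End ℝ (TwForms V L) :=
  ((1 / 2 : ℝ) • ∑ i,
    (LinearMap.mulRight ℝ (twClifford V L (0, (Module.finBasis ℝ V).coord i))
        ∘ₗ twClifford V L ∘ₗ LinearMap.applyₗ ((Module.finBasis ℝ V) i, 0)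
      + LinearMap.mulRight ℝ (twClifford V L ((Module.finBasis ℝ V) i, 0))
        ∘ₗ twClifford V L ∘ₗ LinearMap.applyₗ (0, (Module.finBasis ℝ V).coord i)))
    ∘ₗ (So V).subtype

/-- `σ(a)` induces `a` on `V ⊕ V*`: `[σ(a), c(x)] = c(a x)`. -/
theorem spinRep_commutator (a : So V) (x : Gen V) :
    spinRep V L a * twClifford V L x - twClifford V L x * spinRep V L a
      = twClifford V L ((a : Module.End ℝ (Gen V)) x) := by
  set c := twClifford V L with hc
  set e := Module.finBasis ℝ V
  set A : Module.End ℝ (Gen V) := (a : Module.End ℝ (Gen V)) with hA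
  have hskew : ∀ x y : Gen V,
      (A x).2 y.1 + y.2 (A x).1 = -(x.2 (A y).1 + (A y).2 x.1) := by
    intro x y
    have h := LinearMap.mem_skewAdjointSubmodule _ |>.1 a.2 x y
    simp only [metric, LinearMap.mk₂_apply, Pi.neg_apply, map_neg] at h
    linarith
  have hterm : ∀ u v : Gen V, c (A u) * c v * c x - c x * (c (A u) * c v)
      = (v.2 x.1 + x.2 v.1) • c (A u) + (u.2 (A x).1 + (A x).2 u.1) • c v := by
    intro u v
    have h1 := twClifford_anticomm V L v x
    have h2 := twClifford_anticomm V L (A u) x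
    rw [hskew u x] at h2
    rw [← hc] at h1 h2
    exact commutator_aux _ _ _ _ _ h1 h2
  have hS : spinRep V L a = (1 / 2 : ℝ) • ∑ i,
      (c (A (e i, 0)) * c (0, e.coord i) + c (A (0, e.coord i)) * c (e i, 0)) := by
    simp [spinRep, c, e, A]
  have hexp : ∀ y : Gen V, y = ∑ i, (y.1 |> e.coord i) • ((e i, 0) : Gen V)
      + ∑ i, (y.2 (e i)) • ((0, e.coord i) : Gen V) := by
    intro y
    refine Prod.ext ?_ ?_
    · simp [Prod.fst_sum, e.sum_repr]
    · refine e.ext fun j => ?_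
      simp [Prod.snd_sum]
  have hx : c (A x) = ∑ i, (e.coord i x.1) • c (A (e i, 0))
      + ∑ i, (x.2 (e i)) • c (A (0, e.coord i)) := by
    conv_lhs => rw [hexp x]
    simp only [map_add, map_sum, map_smul]
  have hAx : c (A x) = ∑ i, (e.coord i (A x).1) • c (e i, 0)
      + ∑ i, ((A x).2 (e i)) • c (0, e.coord i) := by
    conv_lhs => rw [hexp (A x)]
    simp only [map_add, map_sum, map_smul]
  have hsum : ∑ i, ((c (A (e i, 0)) * c (0, e.coord i) + c (A (0, e.coord i)) * c (e i, 0)) * c x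
      - c x * (c (A (e i, 0)) * c (0, e.coord i) + c (A (0, e.coord i)) * c (e i, 0)))
      = c (A x) + c (A x) := by
    conv_rhs => rw [hx]
    conv_rhs => arg 2; rw [← hx, hAx]
    simp only [← Finset.sum_add_distrib]
    refine Finset.sum_congr rfl fun i _ => ?_
    rw [add_mul, mul_add, add_sub_add_comm, hterm, hterm]
    simp
    abel
  rw [Finset.sum_sub_distrib, ← Finset.sum_mul, ← Finset.mul_sum] at hsum
  rw [hS]
  exact half_commutator_aux _ _ _ hsum

/-- The moment map as a linear form on `𝔰𝔬(V ⊕ V*)`: `a ↦ ½ ⟨σ(a)ρ, ρ⟩`. -/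
def momentDual (sq : L ⊗[ℝ] L ≃ₗ[ℝ] ⋀[ℝ]^6 V) (ρ : Spinor V L) : Module.Dual ℝ (So V) :=
  (1 / 2 : ℝ) • ((twForm sq).flip (ρ : TwForms V L)
    ∘ₗ LinearMap.applyₗ (ρ : TwForms V L) ∘ₗ spinRep V L)

/-- The moment map `μ : S → 𝔰𝔬(V ⊕ V*)`, after identifying the Lie algebra with its dual by means
of `tr(XY)`: `tr(μ(ρ) a) = ½ ⟨σ(a)ρ, ρ⟩` for all `a`. -/
def moment (sq : L ⊗[ℝ] L ≃ₗ[ℝ] ⋀[ℝ]^6 V) (ρ : Spinor V L) : So V :=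
  ((traceForm V).toDual (traceForm_nondegenerate V)).symm (momentDual sq ρ)

/-- The invariant quartic function. The trace of `μ(ρ)²` as an endomorphism of `V ⊕ V*` is
multiplied by `4` (this gives the trace of `μ(ρ)²` in the representation `S`), which is the
normalization with `q(α + β) = 3⟨α, β⟩²` for pure spinors `α, β`. -/
def quartic (sq : L ⊗[ℝ] L ≃ₗ[ℝ] ⋀[ℝ]^6 V) (ρ : Spinor V L) : ℝ :=
  4 * LinearMap.trace ℝ (Gen V)
    ((moment sq ρ : Module.End ℝ (Gen V)) * (moment sq ρ : Module.End ℝ (Gen V)))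

/-- The set `U = {ρ ∈ S : q(ρ) < 0}`. -/
def stableSet (sq : L ⊗[ℝ] L ≃ₗ[ℝ] ⋀[ℝ]^6 V) : Set (Spinor V L) :=
  {ρ | quartic sq ρ < 0}

/-- The function `φ(ρ) = √(-q(ρ)/3)`. -/
def volFun (sq : L ⊗[ℝ] L ≃ₗ[ℝ] ⋀[ℝ]^6 V) (ρ : Spinor V L) : ℝ :=
  Real.sqrt (-quartic sq ρ / 3)

end Spinors

/-! ### Complex spinors -/

section Complex

variable {V L : Type*} [AddCommGroup V] [Module ℝ V] [AddCommGroup L] [Module ℝ L]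

variable (V L) in
/-- The complexification of the Clifford action, of `(V ⊕ V*) ⊗ ℂ` on `Λ*V* ⊗ L ⊗ ℂ`. -/
def complexClifford : (ℂ ⊗[ℝ] Gen V) →ₗ[ℂ] Module.End ℂ (ℂ ⊗[ℝ] TwForms V L) :=
  LinearMap.liftBaseChange ℂ
    (LinearMap.baseChangeHom ℝ ℂ (TwForms V L) (TwForms V L) ∘ₗ twClifford V L)

/-- The annihilator `E_φ ⊆ (V ⊕ V*) ⊗ ℂ` of a complex spinor `φ ∈ S ⊗ ℂ`. -/
def annihilator (φ : ℂ ⊗[ℝ] Spinor V L) : Submodule ℂ (ℂ ⊗[ℝ] Gen V) :=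
  LinearMap.ker ((complexClifford V L).flip ((spinorSubmodule V L).subtype.baseChange ℂ φ))

/-- A complex spinor is pure if its annihilator has dimension `dim V`. -/
def IsPure (φ : ℂ ⊗[ℝ] Spinor V L) : Prop :=
  Module.finrank ℂ (annihilator φ) = Module.finrank ℝ V

/-- Complex conjugation on `S ⊗ ℂ`. -/
def conjSpinor : (ℂ ⊗[ℝ] Spinor V L) →ₗ[ℝ] (ℂ ⊗[ℝ] Spinor V L) :=
  LinearMap.rTensor (Spinor V L) Complex.conjAe.toLinearMap

/-- A real spinor regarded as a complex spinor. -/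
def ofReal (ρ : Spinor V L) : ℂ ⊗[ℝ] Spinor V L := (1 : ℂ) ⊗ₜ[ℝ] ρ

/-- `φ` is the pure spinor belonging to `ρ`: `ρ = φ + φ̄` with `φ` pure and `⟨φ, φ̄⟩ = i φ(ρ)`. The
last condition distinguishes `φ` from `φ̄`. -/
def IsPureHalf [FiniteDimensional ℝ V] (sq : L ⊗[ℝ] L ≃ₗ[ℝ] ⋀[ℝ]^6 V)
    (ρ : Spinor V L) (φ : ℂ ⊗[ℝ] Spinor V L) : Prop :=
  IsPure φ ∧ ofReal ρ = φ + conjSpinor φ ∧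
    (spinForm sq).baseChange ℂ φ (conjSpinor φ) = Complex.I * (volFun sq ρ : ℂ)

end Complex

/-! ### Calculus on the vector space `S` -/

section Norm

variable (V L : Type*) [AddCommGroup V] [Module ℝ V] [AddCommGroup L] [Module ℝ L]
  [FiniteDimensional ℝ V] [FiniteDimensional ℝ L]

instance : FiniteDimensional ℝ (Forms V) :=
  Module.Finite.of_basis (Module.finBasis ℝ (Module.Dual ℝ V)).ExteriorAlgebra

/-- Some linear coordinates on the finite-dimensional space `S`. -/
def spinorCoord :
    Spinor V L ≃ₗ[ℝ] EuclideanSpace ℝ (Fin (Module.finrank ℝ (Spinor V L))) :=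
  (Module.finBasis ℝ (Spinor V L)).equivFun ≪≫ₗ (WithLp.linearEquiv 2 ℝ _).symm

/-- A norm on the finite-dimensional space `S`, obtained from linear coordinates. All norms on `S`
are equivalent, so it serves only to give access to the calculus library. -/
instance : NormedAddCommGroup (Spinor V L) :=
  NormedAddCommGroup.induced _ _ (spinorCoord V L).toLinearMap (spinorCoord V L).injective

instance : NormedSpace ℝ (Spinor V L) :=
  NormedSpace.induced ℝ _ _ (spinorCoord V L).toLinearMap

end Norm

section Calculus

variable {E : Type*} [NormedAddCommGroup E] [NormedSpace ℝ E]

/-- `X` is the Hamiltonian vector field of `f` on `U` for the constant form `B`: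
`f` is differentiable on `U` and `B(X, ·) = df` there. -/
def IsHamiltonianVectorField (B : LinearMap.BilinForm ℝ E) (f : E → ℝ) (X : E → E) (U : Set E) :
    Prop :=
  ∀ x ∈ U, DifferentiableAt ℝ f x ∧ ∀ v : E, B (X x) v = fderiv ℝ f x v

/-- `J` is a (smooth) almost complex structure on the open set `U` of the vector space `E`. -/
def IsAlmostComplexStructure (J : E → E →L[ℝ] E) (U : Set E) : Prop :=
  ContDiffOn ℝ ∞ J U ∧ ∀ x ∈ U, ∀ v : E, J x (J x v) = -v

/-- `J` is integrable on `U`: around each point there are smooth coordinates with values in `ℂⁿ`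
whose differential takes `J` to multiplication by `i`, so that `J` is the almost complex structure
of a complex manifold. -/
def IsIntegrable (J : E → E →L[ℝ] E) (U : Set E) : Prop :=
  ∀ x ∈ U, ∃ (n : ℕ) (z : OpenPartialHomeomorph E (EuclideanSpace ℂ (Fin n))),
    x ∈ z.source ∧ z.source ⊆ U ∧ ContDiffOn ℝ ∞ z z.source ∧ ContDiffOn ℝ ∞ z.symm z.target ∧
      ∀ y ∈ z.source, ∀ v : E, fderiv ℝ z y (J y v) = Complex.I • fderiv ℝ z y v

end Calculus

end SpinSix

end

/-! Write c for the Clifford action, σ(A) = `quantize c A` for the spin action of A in the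
orthogonal Lie algebra, and n for `current c B ρ ρ`, which is the moment map μ(ρ). Everything rests
on one quadratic (Fierz) identity special to dimension six: for ρ even and χ odd, ∑ₖ ⟨ρ, c(fₖ)χ⟩
c(f'ₖ)ρ = -2 σ(n)χ. Both sides are equivariant, so it is enough to check the polarized identity on
the pair consisting of the vacuum and the top form, where σ(n) is a shifted number operator
(`fierzDefect_vacuum`, `fierzDefect_eq_zero`).

Taking χ = c(x)ρ gives c(x)σ(n)ρ = -3 c(nx)ρ and shows that n² is a scalar proportional to q(ρ)
(`current_current`). If q(ρ) = -3f² < 0, then K = (4/f)n has square -1, and ρ̂ = -(4/(3f)) σ(n)ρ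
satisfies c(Kx)ρ = c(x)ρ̂. Thus ρ + iρ̂ is annihilated by the vectors Kx + ix, a complex space of
dimension six, and is pure. Conversely, if ρ + iη is pure with ⟨ρ, η⟩ ≠ 0, the vanishing of the
moment map on pure spinors makes n a multiple of the complex structure cut out by the annihilator;
so η is determined by ρ (`IsConjugate.current_eq`, `IsConjugate.momentAction_eq`). This gives
existence and uniqueness, and also the circle action, since a phase does not change the annihilator.

Differentiating q shows dφ = ⟨ρ̂, ·⟩, so X(ρ) = ρ̂. The polarized Fierz identity computes DX = -σ(K)
plus a correction of rank two. On the plane of ρ and ρ̂ the operator σ(K) has eigenvalues ±3i,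
elsewhere ±i, and the correction turns 3 into 1; hence J² = -1. Integrability is then automatic:
when J is itself the derivative of a vector field X, the map (1 - J₀X)/2 is a holomorphic chart near
a point where J = J₀ (`isIntegrable_fderiv`). -/

noncomputable section

namespace SpinSix

/-! ### Clifford modules over `V ⊕ V*` -/

section CliffordModule

variable {V : Type*} [AddCommGroup V] [Module ℝ V]

variable (V) in
/-- The symmetric form `(v + ξ, w + η) ↦ ξ(w) + η(v)`, which is `-2` times the inner product. -/
def pairing : LinearMap.BilinForm ℝ (Gen V) :=
  LinearMap.mk₂ ℝ (fun x y : Gen V => x.2 y.1 + y.2 x.1)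
    (fun x x' y => by simp; ring) (fun c x y => by simp; ring)
    (fun x y y' => by simp; ring) (fun c x y => by simp; ring)

theorem pairing_apply (x y : Gen V) : pairing V x y = x.2 y.1 + y.2 x.1 := rfl

theorem pairing_comm (x y : Gen V) : pairing V x y = pairing V y x := add_comm _ _

theorem metric_eq_pairing (x y : Gen V) : metric V x y = -(1 / 2) * pairing V x y := rfl

theorem mem_So_iff (A : Module.End ℝ (Gen V)) :
    A ∈ So V ↔ ∀ x y, pairing V (A x) y = -pairing V x (A y) := by
  refine (LinearMap.mem_skewAdjointSubmodule _).trans (forall₂_congr fun x y => ?_)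
  simp only [Pi.neg_apply, metric_eq_pairing, map_neg]
  constructor <;> intro h <;> linarith

theorem pairing_ext [FiniteDimensional ℝ V] {x x' : Gen V}
    (h : ∀ y, pairing V x y = pairing V x' y) : x = x' := by
  refine Prod.ext ?_ ?_
  · rw [← sub_eq_zero]
    refine (Module.forall_dual_apply_eq_zero_iff ℝ _).1 fun f => ?_
    have := h (0, f)
    simp [pairing_apply] at this
    simp [this]
  · refine LinearMap.ext fun v => ?_
    simpa [pairing_apply] using h (v, 0)

variable (V) in
/-- The rotation `z ↦ (y, z) x - (x, z) y` in the plane of `x` and `y`. -/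
def rotation (x y : Gen V) : Module.End ℝ (Gen V) :=
  (pairing V y).smulRight x - (pairing V x).smulRight y

theorem rotation_apply (x y z : Gen V) :
    rotation V x y z = pairing V y z • x - pairing V x z • y := by
  simp [rotation]

theorem rotation_mem_So (x y : Gen V) : rotation V x y ∈ So V := by
  rw [mem_So_iff]
  intro z w
  simp only [rotation_apply, map_sub, map_smul, LinearMap.sub_apply, LinearMap.smul_apply,
    smul_eq_mul]
  rw [pairing_comm z x, pairing_comm z y]
  ring

variable [FiniteDimensional ℝ V]

theorem trace_mul_rotation (A : Module.End ℝ (Gen V)) (x y : Gen V) :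
    LinearMap.trace ℝ (Gen V) (A * rotation V x y) = pairing V y (A x) - pairing V x (A y) := by
  have e : ∀ (f : Module.Dual ℝ (Gen V)) (z : Gen V), A * f.smulRight z = f.smulRight (A z) := by
    intro f z
    apply LinearMap.ext
    intro w
    simp only [Module.End.mul_apply, LinearMap.smulRight_apply, map_smul]
  rw [rotation, mul_sub, e, e, map_sub, LinearMap.trace_smulRight, LinearMap.trace_smulRight]

variable (V) in
/-- A basis of `V ⊕ V*` made of a basis of `V` and its dual basis. -/
def frame : Fin (Module.finrank ℝ V) ⊕ Fin (Module.finrank ℝ V) → Gen V :=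
  Sum.elim (fun i => (Module.finBasis ℝ V i, 0)) (fun i => (0, (Module.finBasis ℝ V).coord i))

/-- Swapping the two summands of the index set passes from a frame vector to its dual, so sums over
k of fₖ against its swap are contractions with the inverse of the pairing. -/
theorem sum_pairing_frame (y : Gen V) :
    ∑ k, pairing V y (frame V k) • frame V k.swap = y := by
  rw [Fintype.sum_sum_type]
  refine Prod.ext ?_ ?_
  · simp [frame, pairing_apply, Prod.fst_sum, (Module.finBasis ℝ V).sum_repr]
  · refine (Module.finBasis ℝ V).ext fun j => ?_
    simp [frame, pairing_apply, Prod.snd_sum]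

theorem sum_pairing_frame_map {N : Type*} [AddCommGroup N] [Module ℝ N] (f : Gen V →ₗ[ℝ] N)
    (y : Gen V) : ∑ k, pairing V y (frame V k) • f (frame V k.swap) = f y := by
  conv_rhs => rw [← sum_pairing_frame y]
  simp only [map_sum, map_smul]

theorem sum_pairing_frame_swap_map {N : Type*} [AddCommGroup N] [Module ℝ N]
    (f : Gen V →ₗ[ℝ] N) (y : Gen V) :
    ∑ k, pairing V y (frame V (Sum.swap k)) • f (frame V k) = f y := by
  rw [← sum_pairing_frame_map f y]
  exact Fintype.sum_equiv (Equiv.sumComm _ _) _ _ fun k => by simp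

/-- The tensor dual to the inner product is invariant under `𝔰𝔬(V ⊕ V*)`. -/
theorem sum_frame_invariant {N : Type*} [AddCommGroup N] [Module ℝ N]
    (β : Gen V →ₗ[ℝ] Gen V →ₗ[ℝ] N) {A : Module.End ℝ (Gen V)} (hA : A ∈ So V) :
    ∑ k, (β (A (frame V k)) (frame V k.swap) + β (frame V k) (A (frame V k.swap))) = 0 := by
  rw [mem_So_iff] at hA
  have h1 : ∀ k, β (A (frame V k)) (frame V k.swap)
      = ∑ l, pairing V (A (frame V k)) (frame V l) • β (frame V l.swap) (frame V k.swap) :=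
    fun k => (sum_pairing_frame_map (β.flip (frame V k.swap)) _).symm
  have h2 : ∀ k, β (frame V (Sum.swap k)) (A (frame V k))
      = ∑ l, pairing V (A (frame V k)) (frame V l) • β (frame V k.swap) (frame V l.swap) :=
    fun k => (sum_pairing_frame_map (β (frame V k.swap)) _).symm
  have h3 : ∑ k, β (frame V k) (A (frame V (Sum.swap k)))
      = ∑ k, β (frame V (Sum.swap k)) (A (frame V k)) :=
    Fintype.sum_equiv (Equiv.sumComm _ _) _ _ fun k => by simp
  rw [Finset.sum_add_distrib, h3]
  simp only [h1, h2]
  -- Once the indices of one double sum are exchanged, both run over the same values of β, with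
  -- coefficients (A fₗ, fₖ) and (A fₖ, fₗ), which cancel because A is skew.
  rw [Finset.sum_comm, ← Finset.sum_add_distrib]
  refine Finset.sum_eq_zero fun k _ => ?_
  rw [← Finset.sum_add_distrib]
  refine Finset.sum_eq_zero fun l _ => ?_
  rw [hA, pairing_comm, neg_smul, neg_add_cancel]

variable {M : Type*} [AddCommGroup M] [Module ℝ M]

/-- A module over the Clifford algebra of `V ⊕ V*` with an alternating form for which
the vectors act by self-adjoint operators. -/
structure IsCliffordModule (c : Gen V →ₗ[ℝ] Module.End ℝ M) (B : LinearMap.BilinForm ℝ M) :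
    Prop where
  anticomm : ∀ x y, c x * c y + c y * c x = pairing V x y • (1 : Module.End ℝ M)
  adj : ∀ x φ ψ, B (c x φ) ψ = B φ (c x ψ)
  alt : ∀ φ, B φ φ = 0

section

variable (c : Gen V →ₗ[ℝ] Module.End ℝ M) (B : LinearMap.BilinForm ℝ M)

/-- The operator `½ ∑ₖ c(A fₖ) c(f'ₖ)`, for dual bases `fₖ`, `f'ₖ` of `V ⊕ V*`. -/
def quantize : Module.End ℝ (Gen V) →ₗ[ℝ] Module.End ℝ M :=
  (1 / 2 : ℝ) • ∑ k, LinearMap.mulRight ℝ (c (frame V (Sum.swap k)))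
    ∘ₗ c ∘ₗ LinearMap.applyₗ (frame V k)

theorem quantize_apply (A : Module.End ℝ (Gen V)) :
    quantize c A = (1 / 2 : ℝ) • ∑ k, c (A (frame V k)) * c (frame V (Sum.swap k)) := by
  simp [quantize, -Fintype.sum_sum_type]

/-- The endomorphism `n` of `V ⊕ V*` with `(n x, y) = ¼ ⟨c(y)ρ, c(x)ρ'⟩`. -/
def current : M →ₗ[ℝ] M →ₗ[ℝ] Module.End ℝ (Gen V) :=
  LinearMap.mk₂ ℝ (fun ρ ρ' => (1 / 4 : ℝ) • ∑ k,
      (B (c (frame V k) ρ) ∘ₗ c.flip ρ').smulRight (frame V (Sum.swap k)))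
    (fun a b ρ => LinearMap.ext fun x => by
      simp [-Fintype.sum_sum_type, Finset.sum_add_distrib, add_smul])
    (fun r a ρ => LinearMap.ext fun x => by
      simp [-Fintype.sum_sum_type, Finset.smul_sum, smul_smul, mul_assoc, mul_left_comm])
    (fun a b ρ => LinearMap.ext fun x => by
      simp [-Fintype.sum_sum_type, Finset.sum_add_distrib, add_smul])
    (fun r a ρ => LinearMap.ext fun x => by
      simp [-Fintype.sum_sum_type, Finset.smul_sum, smul_smul, mul_assoc, mul_left_comm])

/-- The operator `χ ↦ ∑ₖ ⟨ρ, c(fₖ)χ⟩ c(f'ₖ)ρ'`. -/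
def exchange : M →ₗ[ℝ] M →ₗ[ℝ] Module.End ℝ M :=
  LinearMap.mk₂ ℝ (fun ρ ρ' => ∑ k,
      (B ρ ∘ₗ c (frame V k)).smulRight (c (frame V (Sum.swap k)) ρ'))
    (fun a b ρ => LinearMap.ext fun x => by
      simp [-Fintype.sum_sum_type, Finset.sum_add_distrib, add_smul])
    (fun r a ρ => LinearMap.ext fun x => by
      simp [-Fintype.sum_sum_type, Finset.smul_sum, smul_smul])
    (fun a b ρ => LinearMap.ext fun x => by
      simp [-Fintype.sum_sum_type, Finset.sum_add_distrib])
    (fun r a ρ => LinearMap.ext fun x => by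
      simp [-Fintype.sum_sum_type, Finset.smul_sum, smul_smul, mul_comm])

theorem exchange_apply (ρ ρ' χ : M) : exchange c B ρ ρ' χ
    = ∑ k, B ρ (c (frame V k) χ) • c (frame V (Sum.swap k)) ρ' := by
  simp [exchange, -Fintype.sum_sum_type]

theorem pairing_current (ρ ρ' : M) (x y : Gen V) :
    pairing V (current c B ρ ρ' x) y = 1 / 4 * B (c y ρ) (c x ρ') := by
  have h := sum_pairing_frame_map ((LinearMap.flip B (c x ρ')) ∘ₗ c.flip ρ) y
  simp only [LinearMap.comp_apply, LinearMap.flip_apply] at h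
  rw [← h]
  simp only [current, LinearMap.mk₂_apply, LinearMap.smul_apply, map_smul, LinearMap.sum_apply,
    map_sum, LinearMap.smulRight_apply, LinearMap.comp_apply, LinearMap.flip_apply, smul_eq_mul]
  congr 1
  refine Fintype.sum_equiv (Equiv.sumComm _ _) _ _ fun k => ?_
  simp only [Equiv.sumComm_apply, Sum.swap_swap]
  rw [pairing_comm, mul_comm]

/-- The defect in the Fierz identity. -/
def fierzDefect : M →ₗ[ℝ] M →ₗ[ℝ] Module.End ℝ M :=
  (exchange c B + (exchange c B).flip) + (2 : ℝ) •
    ((current c B).compr₂ (quantize c) + ((current c B).compr₂ (quantize c)).flip)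

theorem fierzDefect_apply (ρ ρ' : M) : fierzDefect c B ρ ρ'
    = exchange c B ρ ρ' + exchange c B ρ' ρ + (2 : ℝ) • (quantize c (current c B ρ ρ')
        + quantize c (current c B ρ' ρ)) := by
  simp [fierzDefect]

theorem fierzDefect_comm (ρ ρ' : M) : fierzDefect c B ρ ρ' = fierzDefect c B ρ' ρ := by
  rw [fierzDefect_apply, fierzDefect_apply, add_comm (exchange c B ρ ρ'),
    add_comm (quantize c (current c B ρ ρ'))]

end

end CliffordModule

/-! ### Formal consequences of the Clifford relations, and equivariance -/

section CliffordModule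

variable {V : Type*} [AddCommGroup V] [Module ℝ V]
  {M : Type*} [AddCommGroup M] [Module ℝ M]
  {c : Gen V →ₗ[ℝ] Module.End ℝ M} {B : LinearMap.BilinForm ℝ M}

namespace IsCliffordModule

theorem skew (h : IsCliffordModule c B) (φ ψ : M) : B φ ψ = -B ψ φ := by
  have := h.alt (φ + ψ)
  simp only [map_add, LinearMap.add_apply, h.alt] at this
  linarith

theorem anticomm_apply (h : IsCliffordModule c B) (x y : Gen V) (φ : M) :
    c x (c y φ) + c y (c x φ) = pairing V x y • φ := by
  simpa using LinearMap.congr_fun (h.anticomm x y) φ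

/-- Some anticommutator c(v)c(f) + c(f)c(v) is the nonzero scalar f(v). Identities between even
spinors are proved below by applying an arbitrary c(x) and landing in the odd spinors, where the
Fierz identity applies. -/
theorem eq_zero_of_forall [Nontrivial V] (h : IsCliffordModule c B) {φ : M}
    (hφ : ∀ x, c x φ = 0) : φ = 0 := by
  obtain ⟨v, hv⟩ := exists_ne (0 : V)
  obtain ⟨f, hf⟩ : ∃ f : Module.Dual ℝ V, f v ≠ 0 := by
    by_contra! hc
    exact hv ((Module.forall_dual_apply_eq_zero_iff ℝ v).1 hc)
  have := h.anticomm_apply (v, 0) (0, f) φ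
  rw [hφ, hφ, map_zero, map_zero, add_zero] at this
  simpa [pairing_apply, hf] using this.symm

theorem clifford_mul_commutator (h : IsCliffordModule c B) (x y z : Gen V) :
    c x * c y * c z - c z * (c x * c y) = c (rotation V x y z) := by
  have h1 := h.anticomm y z
  have h2 := h.anticomm x z
  have e : c x * c y * c z - c z * (c x * c y)
      = c x * (c y * c z + c z * c y) - (c x * c z + c z * c x) * c y := by noncomm_ring
  rw [e, h1, h2, rotation_apply]
  simp

/-- Transposition reverses the product of two self-adjoint operators, and orthogonality makes the
factors anticommute. So c(x)c(y) is an infinitesimal symmetry of the form. -/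
theorem clifford_mul_skew (h : IsCliffordModule c B) {x y : Gen V} (hxy : pairing V x y = 0)
    (φ ψ : M) : B ((c x * c y) φ) ψ = -B φ ((c x * c y) ψ) := by
  have e := h.anticomm_apply x y ψ
  rw [hxy, zero_smul] at e
  rw [Module.End.mul_apply, Module.End.mul_apply, h.adj, h.adj, ← map_neg,
    eq_neg_of_add_eq_zero_left e, neg_neg]

variable [FiniteDimensional ℝ V]

/-- Commuting c(x) past c(Afₖ)c(f'ₖ) leaves two contractions. Each sums to c(Ax), the second because
A is skew, and the factor ½ compensates. -/
theorem quantize_commutator (h : IsCliffordModule c B) {A : Module.End ℝ (Gen V)} (hA : A ∈ So V)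
    (x : Gen V) : quantize c A * c x - c x * quantize c A = c (A x) := by
  have hterm : ∀ a b : Gen V, c a * c b * c x - c x * (c a * c b)
      = pairing V x b • c a - pairing V a x • c b := by
    intro a b
    have h1 := h.anticomm b x
    have h2 := h.anticomm a x
    have e : c a * c b * c x - c x * (c a * c b)
        = c a * (c b * c x + c x * c b) - (c a * c x + c x * c a) * c b := by noncomm_ring
    rw [e, h1, h2, pairing_comm b x]
    simp
  have e1 := sum_pairing_frame_swap_map (c ∘ₗ A) x
  have e2 := sum_pairing_frame_map c (A x)
  have e3 : ∀ k, pairing V (A (frame V k)) x = -pairing V (A x) (frame V k) := fun k => by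
    rw [(mem_So_iff A).1 hA, pairing_comm]
  rw [quantize_apply]
  refine half_commutator_aux _ _ _ ?_
  rw [Finset.sum_mul, Finset.mul_sum, ← Finset.sum_sub_distrib]
  simp only [hterm, e3, neg_smul, sub_neg_eq_add, Finset.sum_add_distrib]
  exact congrArg₂ (· + ·) e1 e2

theorem quantize_commutator_apply (h : IsCliffordModule c B) {A : Module.End ℝ (Gen V)}
    (hA : A ∈ So V) (x : Gen V) (φ : M) :
    quantize c A (c x φ) = c x (quantize c A φ) + c (A x) φ := by
  have := LinearMap.congr_fun (h.quantize_commutator hA x) φ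
  simp only [LinearMap.sub_apply, Module.End.mul_apply] at this
  rw [← this]
  abel

theorem quantize_rotation (x y : Gen V) :
    quantize c (rotation V x y) = (1 / 2 : ℝ) • (c x * c y - c y * c x) := by
  have e1 := sum_pairing_frame_map (LinearMap.mulLeft ℝ (c x) ∘ₗ c) y
  have e2 := sum_pairing_frame_map (LinearMap.mulLeft ℝ (c y) ∘ₗ c) x
  simp only [LinearMap.comp_apply, LinearMap.mulLeft_apply] at e1 e2
  rw [quantize_apply, ← e1, ← e2, ← Finset.sum_sub_distrib]
  simp only [rotation_apply, map_sub, map_smul, sub_mul, smul_mul_assoc]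

/-- Transposition reverses each product c(Afₖ)c(f'ₖ); invariance of the tensor ∑ fₖ ⊗ f'ₖ under A
moves A back to the first factor at the cost of a sign. -/
theorem quantize_skew (h : IsCliffordModule c B) {A : Module.End ℝ (Gen V)} (hA : A ∈ So V)
    (φ ψ : M) : B (quantize c A φ) ψ = -B φ (quantize c A ψ) := by
  have e1 := sum_frame_invariant ((LinearMap.mul ℝ (Module.End ℝ M)).compl₁₂ c c) hA
  simp only [LinearMap.compl₁₂_apply, LinearMap.mul_apply', Finset.sum_add_distrib] at e1
  have e2 : ∑ k, c (frame V k) * c (A (frame V (Sum.swap k)))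
      = ∑ k, c (frame V (Sum.swap k)) * c (A (frame V k)) :=
    Fintype.sum_equiv (Equiv.sumComm _ _) _ _ fun k => by simp
  rw [e2] at e1
  have e3 : B (quantize c A φ) ψ
      = B φ ((1 / 2 : ℝ) • (∑ k, c (frame V (Sum.swap k)) * c (A (frame V k))) ψ) := by
    rw [quantize_apply]
    simp only [LinearMap.smul_apply, LinearMap.sum_apply, map_smul, map_sum, Module.End.mul_apply,
      h.adj]
  rw [e3, eq_neg_of_add_eq_zero_right e1, quantize_apply]
  simp

theorem current_self_mem_So (h : IsCliffordModule c B) (ρ : M) : current c B ρ ρ ∈ So V := by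
  rw [mem_So_iff]
  intro x y
  rw [pairing_comm x, pairing_current, pairing_current, h.skew]
  ring

theorem current_add_current_mem_So (h : IsCliffordModule c B) (ρ ρ' : M) :
    current c B ρ ρ' + current c B ρ' ρ ∈ So V := by
  have e : current c B ρ ρ' + current c B ρ' ρ
      = current c B (ρ + ρ') (ρ + ρ') - current c B ρ ρ - current c B ρ' ρ' := by
    simp only [map_add, LinearMap.add_apply]
    abel
  rw [e]
  exact sub_mem (sub_mem (h.current_self_mem_So _) (h.current_self_mem_So _))
    (h.current_self_mem_So _)

/-- The symmetric part of ⟨c(y)ρ, c(x)ρ'⟩ in x and y is fixed by the anticommutator, so exchanging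
the spinors costs only a scalar. -/
theorem current_swap (h : IsCliffordModule c B) (ρ ρ' : M) (x : Gen V) :
    current c B ρ' ρ x = current c B ρ ρ' x - (1 / 4 * B ρ ρ') • x := by
  refine pairing_ext fun y => ?_
  have e1 := congrArg (B ρ) (h.anticomm_apply x y ρ')
  rw [map_add, ← h.adj x ρ, ← h.adj y ρ, map_smul, smul_eq_mul] at e1
  simp only [map_sub, map_smul, LinearMap.sub_apply, LinearMap.smul_apply, smul_eq_mul]
  rw [pairing_current, pairing_current, h.skew (c y ρ')]
  linarith

/-- By self-adjointness ⟨ρ, c(fₖ)c(x)τ⟩ = ⟨c(fₖ)ρ, c(x)τ⟩, a coefficient of the current. On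
arguments of the form c(x)τ the Fierz identity therefore becomes a relation among currents. -/
theorem exchange_clifford (h : IsCliffordModule c B) (ρ ρ' τ : M) (x : Gen V) :
    exchange c B ρ ρ' (c x τ) = (4 : ℝ) • c (current c B ρ τ x) ρ' := by
  have e := sum_pairing_frame_map (c.flip ρ') (current c B ρ τ x)
  simp only [LinearMap.flip_apply] at e
  rw [exchange_apply, ← e, Finset.smul_sum]
  refine Finset.sum_congr rfl fun k _ => ?_
  rw [pairing_current, smul_smul, ← h.adj]
  congr 1
  ring

/-! The Fierz defect is equivariant under the infinitesimal symmetries `u`. -/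

section Invariance

variable {u : Module.End ℝ M} {A : Module.End ℝ (Gen V)}

theorem exchange_invariant (hA : A ∈ So V) (hu : ∀ z, u * c z - c z * u = c (A z))
    (hB : ∀ φ ψ, B (u φ) ψ = -B φ (u ψ)) (ρ ρ' : M) :
    exchange c B (u ρ) ρ' + exchange c B ρ (u ρ')
      = u * exchange c B ρ ρ' - exchange c B ρ ρ' * u := by
  have hu' : ∀ z φ, u (c z φ) = c z (u φ) + c (A z) φ := fun z φ => by
    rw [← hu z]
    simp
  refine LinearMap.ext fun χ => ?_
  let β : Gen V →ₗ[ℝ] Gen V →ₗ[ℝ] M :=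
    (LinearMap.lsmul ℝ M).compl₁₂ (B ρ ∘ₗ c.flip χ) (c.flip ρ')
  have hβ : ∀ y z, β y z = B ρ (c y χ) • c z ρ' := fun y z => rfl
  have e := sum_frame_invariant β hA
  simp only [hβ] at e
  have e2 : ∀ z, u (c z ρ') = c z (u ρ') + c (A z) ρ' := fun z => hu' z _
  simp only [LinearMap.add_apply, LinearMap.sub_apply, Module.End.mul_apply, exchange_apply, hB,
    hu', map_sum, map_smul, map_add]
  rw [← Finset.sum_add_distrib, ← Finset.sum_sub_distrib, ← sub_eq_zero, ← Finset.sum_sub_distrib,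
    ← neg_eq_zero, ← Finset.sum_neg_distrib, ← e]
  refine Finset.sum_congr rfl fun k _ => ?_
  module

theorem current_invariant (hA : A ∈ So V) (hu : ∀ z, u * c z - c z * u = c (A z))
    (hB : ∀ φ ψ, B (u φ) ψ = -B φ (u ψ)) (ρ ρ' : M) :
    current c B (u ρ) ρ' + current c B ρ (u ρ')
      = A * current c B ρ ρ' - current c B ρ ρ' * A := by
  have hu' : ∀ z φ, c z (u φ) = u (c z φ) - c (A z) φ := fun z φ => by
    rw [← hu z]
    simp
  refine LinearMap.ext fun x => pairing_ext fun y => ?_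
  simp only [LinearMap.add_apply, LinearMap.sub_apply, Module.End.mul_apply, map_add, map_sub]
  rw [(mem_So_iff A).1 hA]
  simp only [pairing_current, hu', map_sub, LinearMap.sub_apply, hB]
  ring

theorem quantize_invariant (hA : A ∈ So V) (hu : ∀ z, u * c z - c z * u = c (A z))
    (N : Module.End ℝ (Gen V)) :
    quantize c (A * N - N * A) = u * quantize c N - quantize c N * u := by
  have e := sum_frame_invariant ((LinearMap.mul ℝ (Module.End ℝ M)).compl₁₂ (c ∘ₗ N) c) hA
  simp only [LinearMap.compl₁₂_apply, LinearMap.mul_apply', LinearMap.comp_apply] at e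
  rw [quantize_apply, quantize_apply, mul_smul_comm, smul_mul_assoc, ← smul_sub, Finset.mul_sum,
    Finset.sum_mul, ← Finset.sum_sub_distrib]
  congr 1
  rw [← add_zero (∑ k, _), ← e, ← Finset.sum_add_distrib]
  refine Finset.sum_congr rfl fun k _ => ?_
  have h1 := hu (N (frame V k))
  have h2 := hu (frame V (Sum.swap k))
  simp only [LinearMap.sub_apply, Module.End.mul_apply, map_sub]
  rw [← h1, ← h2]
  noncomm_ring

theorem fierzDefect_invariant (hA : A ∈ So V) (hu : ∀ z, u * c z - c z * u = c (A z))
    (hB : ∀ φ ψ, B (u φ) ψ = -B φ (u ψ)) (ρ ρ' : M) :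
    fierzDefect c B (u ρ) ρ' + fierzDefect c B ρ (u ρ')
      = u * fierzDefect c B ρ ρ' - fierzDefect c B ρ ρ' * u := by
  have e1 := exchange_invariant hA hu hB ρ ρ'
  have e2 := exchange_invariant hA hu hB ρ' ρ
  have e3 := congrArg (quantize c) (current_invariant hA hu hB ρ ρ')
  have e4 := congrArg (quantize c) (current_invariant hA hu hB ρ' ρ)
  rw [quantize_invariant hA hu, map_add] at e3 e4
  simp only [fierzDefect_apply]
  have e5 : ∀ a b c d e f g h : Module.End ℝ M,
      a + b + (2 : ℝ) • (c + d) + (e + f + (2 : ℝ) • (g + h))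
        = (a + e) + (f + b) + (2 : ℝ) • ((c + g) + (h + d)) := by
    intros
    module
  rw [e5, e1, e2, e3, e4]
  simp only [mul_add, add_mul, mul_smul_comm, smul_mul_assoc, smul_sub, smul_add]
  abel

end Invariance

/-- Products of two orthogonal vectors supply enough symmetries to carry the Fierz identity from one
pair of spinors to all even pairs. -/
theorem fierzDefect_clifford_mul (h : IsCliffordModule c B) {x y : Gen V}
    (hxy : pairing V x y = 0) (ρ ρ' : M) :
    fierzDefect c B (c x (c y ρ)) ρ' + fierzDefect c B ρ (c x (c y ρ'))
      = c x * c y * fierzDefect c B ρ ρ' - fierzDefect c B ρ ρ' * (c x * c y) :=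
  fierzDefect_invariant (u := c x * c y) (rotation_mem_So x y) (h.clifford_mul_commutator x y)
    (h.clifford_mul_skew hxy) ρ ρ'

end IsCliffordModule

end CliffordModule

/-! ### Consequences of the Fierz identity -/

section Fierz

variable {V : Type*} [AddCommGroup V] [Module ℝ V] [FiniteDimensional ℝ V]
  {M : Type*} [AddCommGroup M] [Module ℝ M]

/-- A Clifford module with a `ℤ/2`-grading `S`, `S'` which satisfies the Fierz identity. -/
structure IsFierzModule (c : Gen V →ₗ[ℝ] Module.End ℝ M) (B : LinearMap.BilinForm ℝ M)
    (S S' : Submodule ℝ M) : Prop extends IsCliffordModule c B where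
  map_even : ∀ x, ∀ φ ∈ S, c x φ ∈ S'
  map_odd : ∀ x, ∀ φ ∈ S', c x φ ∈ S
  fierz : ∀ ρ ∈ S, ∀ ρ' ∈ S, ∀ χ ∈ S', fierzDefect c B ρ ρ' χ = 0

variable (c : Gen V →ₗ[ℝ] Module.End ℝ M) (B : LinearMap.BilinForm ℝ M)

/-- The trilinear map whose diagonal is `σ(μ(ρ))ρ`. -/
def momentAction : M →ₗ[ℝ] M →ₗ[ℝ] M →ₗ[ℝ] M := (current c B).compr₂ (quantize c)

theorem momentAction_apply (a b φ : M) :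
    momentAction c B a b φ = quantize c (current c B a b) φ := rfl

variable {c B} {S S' : Submodule ℝ M}

namespace IsFierzModule

theorem quantize_mem (h : IsFierzModule c B S S') (A : Module.End ℝ (Gen V)) {φ : M}
    (hφ : φ ∈ S) : quantize c A φ ∈ S := by
  rw [quantize_apply]
  simp only [LinearMap.smul_apply, LinearMap.sum_apply, Module.End.mul_apply]
  exact S.smul_mem _ (S.sum_mem fun k _ => h.map_odd _ _ (h.map_even _ _ hφ))

/-- The diagonal of the polarized Fierz identity, divided by two. -/
theorem exchange_self (h : IsFierzModule c B S S') {ρ χ : M} (hρ : ρ ∈ S) (hχ : χ ∈ S') :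
    exchange c B ρ ρ χ = (-2 : ℝ) • quantize c (current c B ρ ρ) χ := by
  have e := h.fierz ρ hρ ρ hρ χ hχ
  rw [fierzDefect_apply] at e
  simp only [LinearMap.add_apply, LinearMap.smul_apply] at e
  have e2 : (2 : ℝ) • (exchange c B ρ ρ χ + (2 : ℝ) • quantize c (current c B ρ ρ) χ) = 0 := by
    rw [← e]
    module
  rw [smul_eq_zero_iff_right two_ne_zero] at e2
  rw [eq_neg_of_add_eq_zero_left e2, neg_smul]

/-- The Fierz identity at χ = c(x)v: the exchange term is a current, and moving σ(n) past c(x)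
contributes c(nx)v. -/
theorem quantize_clifford (h : IsFierzModule c B S S') {ρ v : M} (hρ : ρ ∈ S) (hv : v ∈ S)
    (x : Gen V) : c x (quantize c (current c B ρ ρ) v)
      = (-2 : ℝ) • c (current c B ρ v x) ρ - c (current c B ρ ρ x) v := by
  have e := h.exchange_self hρ (h.map_even x v hv)
  rw [h.exchange_clifford, h.quantize_commutator_apply (h.current_self_mem_So ρ)] at e
  have : (-2 : ℝ) • c x (quantize c (current c B ρ ρ) v)
      = (-2 : ℝ) • ((-2 : ℝ) • c (current c B ρ v x) ρ - c (current c B ρ ρ x) v) := by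
    have e2 : (-2 : ℝ) • c x (quantize c (current c B ρ ρ) v)
        = (-2 : ℝ) • (c x (quantize c (current c B ρ ρ) v) + c (current c B ρ ρ x) v)
          + (2 : ℝ) • c (current c B ρ ρ x) v := by module
    rw [e2, ← e]
    module
  exact smul_right_injective M (by norm_num : (-2 : ℝ) ≠ 0) this

theorem clifford_momentAction (h : IsFierzModule c B S S') {ρ : M} (hρ : ρ ∈ S) (x : Gen V) :
    c x (momentAction c B ρ ρ ρ) = (-3 : ℝ) • c (current c B ρ ρ x) ρ := by
  rw [momentAction_apply, h.quantize_clifford hρ hρ]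
  module

theorem form_clifford (ρ : M) (x y : Gen V) :
    B (c y ρ) (c x ρ) = 4 * pairing V (current c B ρ ρ x) y := by
  rw [pairing_current]
  ring

/-- The numbers ⟨c(y)ρ, c(x)σ(n)ρ⟩ = -12 (n²x, y) are symmetric in x and y because n is skew.
Symmetrizing by the anticommutator gives a multiple of (x, y), so n² is scalar. -/
theorem current_current (h : IsFierzModule c B S S') {ρ : M} (hρ : ρ ∈ S) (x : Gen V) :
    current c B ρ ρ (current c B ρ ρ x) = (B (momentAction c B ρ ρ ρ) ρ / 24) • x := by
  have key : ∀ x y, B (c y ρ) (c x (momentAction c B ρ ρ ρ))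
      = -12 * pairing V (current c B ρ ρ (current c B ρ ρ x)) y := by
    intro x y
    rw [h.clifford_momentAction hρ, map_smul, smul_eq_mul, form_clifford]
    ring
  refine pairing_ext fun y => ?_
  have e1 := key x y
  have e2 := key y x
  have e3 : pairing V (current c B ρ ρ (current c B ρ ρ y)) x
      = pairing V (current c B ρ ρ (current c B ρ ρ x)) y := by
    have hA := (mem_So_iff _).1 (h.current_self_mem_So ρ)
    rw [hA, hA, neg_neg, pairing_comm]
  rw [e3] at e2
  rw [h.adj] at e1 e2
  have e4 := congrArg (B ρ) (h.anticomm_apply x y (momentAction c B ρ ρ ρ))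
  rw [map_add, map_smul, smul_eq_mul, e1, e2, h.skew ρ] at e4
  rw [map_smul, LinearMap.smul_apply, smul_eq_mul]
  linarith

variable [Nontrivial V]

/-- The polarized Fierz identity at χ = c(x)ρ, with c(x) cancelled at the end; the last term comes
from exchanging the arguments of the current. It is what makes the derivative of ρ ↦ σ(μ(ρ))ρ
computable. -/
theorem momentAction_add (h : IsFierzModule c B S S') {ρ v : M} (hρ : ρ ∈ S) (hv : v ∈ S) :
    momentAction c B ρ v ρ + momentAction c B v ρ ρ
      = (2 : ℝ) • momentAction c B ρ ρ v + (3 / 4 * B ρ v) • ρ := by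
  rw [← sub_eq_zero]
  refine h.eq_zero_of_forall fun x => ?_
  have e := h.fierz ρ hρ v hv _ (h.map_even x ρ hρ)
  rw [fierzDefect_apply, ← map_add] at e
  simp only [LinearMap.add_apply, LinearMap.smul_apply] at e
  rw [h.exchange_clifford, h.exchange_clifford,
    h.quantize_commutator_apply (h.current_add_current_mem_So ρ v)] at e
  simp only [LinearMap.add_apply, map_add] at e
  have e1 := h.quantize_clifford hρ hv x
  rw [h.current_swap ρ v] at e
  simp only [map_sub, map_smul, LinearMap.sub_apply, LinearMap.smul_apply] at e
  simp only [momentAction_apply, map_sub, map_add, map_smul]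
  rw [e1]
  have e2 : c x (quantize c (current c B ρ v) ρ) + c x (quantize c (current c B v ρ) ρ)
      = (-4 : ℝ) • c (current c B ρ v x) ρ + (3 / 4 * B ρ v) • c x ρ
        - (2 : ℝ) • c (current c B ρ ρ x) v := by
    rw [← sub_eq_zero, ← smul_eq_zero_iff_right (two_ne_zero (α := ℝ)), ← e]
    module
  rw [e2]
  module

end IsFierzModule

variable (c B) in
/-- The quartic invariant `2 ⟨σ(μ(ρ))ρ, ρ⟩` of a Clifford module. -/
def cliffordQuartic (ρ : M) : ℝ :=
  2 * B (momentAction c B ρ ρ ρ) ρ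

variable (c) in
/-- `ρ` and `η` are the real and the imaginary part of (twice) a spinor which is annihilated by
the vectors `k x + i x`. -/
structure IsConjugate (ρ η : M) (k : Gen V → Gen V) : Prop where
  left : ∀ x, c (k x) ρ = c x η
  right : ∀ x, c (k x) η = -c x ρ

variable (c B) in
/-- The conjugate spinor `ρ̂` of a spinor `ρ` with `q(ρ) = -3f²`. -/
def hatSpinor (f : ℝ) (ρ : M) : M := (-(4 / (3 * f))) • momentAction c B ρ ρ ρ

variable (c B) in
/-- The complex structure on `V ⊕ V*` determined by a spinor `ρ` with `q(ρ) = -3f²`. -/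
def genComplex (f : ℝ) (ρ : M) : Module.End ℝ (Gen V) := (4 / f) • current c B ρ ρ

variable (c B) in
/-- The almost complex structure on spinors determined by a spinor `ρ` with `q(ρ) = -3f²`. -/
def spinorComplex (f : ℝ) (ρ v : M) : M :=
  -quantize c (genComplex c B f ρ) v
    + (1 / f) • (B v (hatSpinor c B f ρ) • hatSpinor c B f ρ + B v ρ • ρ)

namespace IsFierzModule

/-! ### Spinors on which the quartic invariant is negative -/

section Negative

variable {ρ : M} {f : ℝ}

theorem hatSpinor_mem (h : IsFierzModule c B S S') (hρ : ρ ∈ S) : hatSpinor c B f ρ ∈ S :=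
  S.smul_mem _ (h.quantize_mem _ hρ)

theorem form_momentAction (hq : cliffordQuartic c B ρ = -3 * f ^ 2) :
    B (momentAction c B ρ ρ ρ) ρ = -(3 / 2) * f ^ 2 := by
  rw [cliffordQuartic] at hq
  linarith

theorem form_hatSpinor (hf : f ≠ 0) (hq : cliffordQuartic c B ρ = -3 * f ^ 2) :
    B (hatSpinor c B f ρ) ρ = 2 * f := by
  rw [hatSpinor, map_smul, LinearMap.smul_apply, form_momentAction hq, smul_eq_mul]
  field_simp
  norm_num

theorem genComplex_mem_So (h : IsFierzModule c B S S') : genComplex c B f ρ ∈ So V :=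
  (So V).smul_mem _ (h.current_self_mem_So ρ)

/-- Here ⟨σ(n)ρ, ρ⟩ = -(3/2)f², hence n² = -f²/16; this explains the factor 4/f in K. -/
theorem genComplex_genComplex (h : IsFierzModule c B S S') (hρ : ρ ∈ S) (hf : f ≠ 0)
    (hq : cliffordQuartic c B ρ = -3 * f ^ 2) (x : Gen V) :
    genComplex c B f ρ (genComplex c B f ρ x) = -x := by
  simp only [genComplex, LinearMap.smul_apply, map_smul]
  rw [h.current_current hρ, form_momentAction hq, smul_smul, smul_smul, ← neg_one_smul ℝ x]
  congr 1
  field_simp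
  norm_num

theorem isConjugate_hatSpinor (h : IsFierzModule c B S S') (hρ : ρ ∈ S) (hf : f ≠ 0)
    (hq : cliffordQuartic c B ρ = -3 * f ^ 2) :
    IsConjugate c ρ (hatSpinor c B f ρ) (genComplex c B f ρ) := by
  have left : ∀ x, c (genComplex c B f ρ x) ρ = c x (hatSpinor c B f ρ) := fun x => by
    rw [hatSpinor, map_smul, h.clifford_momentAction hρ, genComplex, LinearMap.smul_apply,
      map_smul, LinearMap.smul_apply, smul_smul]
    congr 1
    field_simp
  refine ⟨left, fun x => ?_⟩
  rw [← left, h.genComplex_genComplex hρ hf hq, map_neg, LinearMap.neg_apply]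

theorem quantize_genComplex_self (hf : f ≠ 0) :
    quantize c (genComplex c B f ρ) ρ = (-3 : ℝ) • hatSpinor c B f ρ := by
  rw [genComplex, map_smul, LinearMap.smul_apply, hatSpinor, smul_smul, momentAction_apply]
  congr 1
  field_simp

/-- Compare both sides after c(x), using c(x)ρ̂ = c(Kx)ρ to reduce to the action on ρ. With σ(K)ρ =
-3ρ̂ it says that ρ + iρ̂ is an eigenvector of σ(K) with eigenvalue 3i. -/
theorem quantize_genComplex_hatSpinor [Nontrivial V] (h : IsFierzModule c B S S') (hρ : ρ ∈ S)
    (hf : f ≠ 0) (hq : cliffordQuartic c B ρ = -3 * f ^ 2) :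
    quantize c (genComplex c B f ρ) (hatSpinor c B f ρ) = (3 : ℝ) • ρ := by
  have hc := h.isConjugate_hatSpinor hρ hf hq
  rw [← sub_eq_zero]
  refine h.eq_zero_of_forall fun x => ?_
  have e := h.quantize_commutator_apply h.genComplex_mem_So x (hatSpinor c B f ρ) (A := genComplex c B f ρ)
  rw [← hc.left x, h.quantize_commutator_apply h.genComplex_mem_So, hc.right,
    h.genComplex_genComplex hρ hf hq, quantize_genComplex_self hf, map_smul, hc.right] at e
  rw [map_sub, ← add_right_cancel_iff (a := -c x ρ), sub_add_eq_add_sub, ← e, map_smul]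
  simp only [map_neg, LinearMap.neg_apply]
  module

/-- Test the anticommutator of y and Kx against ρ and that of x and y against ρ̂, then subtract: the
terms ⟨c(x)ρ̂, c(y)v⟩ cancel. This failure of K to anticommute with the current is the source of the
rank two term in σ(K)². -/
theorem genComplex_current (h : IsFierzModule c B S S') (hρ : ρ ∈ S) (hf : f ≠ 0)
    (hq : cliffordQuartic c B ρ = -3 * f ^ 2) (v : M) (x : Gen V) :
    genComplex c B f ρ (current c B ρ v x) + current c B ρ v (genComplex c B f ρ x)
      = (1 / 4 * B ρ v) • genComplex c B f ρ x - (1 / 4 * B (hatSpinor c B f ρ) v) • x := by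
  have hc := h.isConjugate_hatSpinor hρ hf hq
  refine pairing_ext fun y => ?_
  have e1 := congrArg (B ρ) (h.anticomm_apply y (genComplex c B f ρ x) v)
  have e2 := congrArg (B (hatSpinor c B f ρ)) (h.anticomm_apply x y v)
  rw [map_add, ← h.adj _ ρ, ← h.adj _ ρ, map_smul, smul_eq_mul, hc.left] at e1
  rw [map_add, ← h.adj x (hatSpinor c B f ρ), ← h.adj y (hatSpinor c B f ρ), map_smul,
    smul_eq_mul] at e2
  simp only [map_add, map_sub, map_smul, LinearMap.add_apply, LinearMap.sub_apply,
    LinearMap.smul_apply, smul_eq_mul]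
  rw [(mem_So_iff _).1 h.genComplex_mem_So, pairing_current, pairing_current, hc.left]
  rw [pairing_comm y] at e1
  linarith

/-- Apply c(x) and commute it past σ(K) twice; the Fierz identity evaluates σ(K) on c(x)v. The
outcome is that σ(K) squares to -1 on the symplectic complement of ρ, ρ̂ and to -9 on their span. -/
theorem quantize_genComplex_quantize [Nontrivial V] (h : IsFierzModule c B S S') (hρ : ρ ∈ S)
    (hf : f ≠ 0) (hq : cliffordQuartic c B ρ = -3 * f ^ 2) {v : M} (hv : v ∈ S) :
    quantize c (genComplex c B f ρ) (quantize c (genComplex c B f ρ) v)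
      = -v + (4 / f) • (B ρ v • hatSpinor c B f ρ - B (hatSpinor c B f ρ) v • ρ) := by
  have hc := h.isConjugate_hatSpinor hρ hf hq
  set X := hatSpinor c B f ρ with hX
  set k := genComplex c B f ρ with hk
  have hkS : k ∈ So V := h.genComplex_mem_So
  -- The Fierz identity at c(x)v, rescaled: -2 · 4/f = -8/f.
  have hs : ∀ x, quantize c k (c x v) = (-(8 / f)) • c (current c B ρ v x) ρ := fun x => by
    have e := h.exchange_self hρ (h.map_even x v hv)
    rw [h.exchange_clifford] at e
    have e2 : quantize c k (c x v) = (-(2 / f)) • ((-2 : ℝ) • quantize c (current c B ρ ρ) (c x v)) := by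
      rw [hk, genComplex, map_smul, LinearMap.smul_apply, smul_smul]
      congr 1
      field_simp
      norm_num
    rw [e2, ← e, smul_smul]
    congr 1
    field_simp
    norm_num
  rw [← sub_eq_zero]
  refine h.eq_zero_of_forall fun x => ?_
  have e1 := h.quantize_commutator_apply hkS x (quantize c k v)
  have e2 := congrArg (quantize c k) (h.quantize_commutator_apply hkS x v)
  have e3 := h.quantize_commutator_apply hkS (k x) v
  have e4 := h.quantize_commutator_apply hkS (current c B ρ v x) ρ
  have e5 := congrArg (fun z => c z ρ) (h.genComplex_current hρ hf hq v x)
  rw [h.genComplex_genComplex hρ hf hq] at e3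
  simp only [← hk, ← hX, map_add, map_sub, map_smul, LinearMap.add_apply, LinearMap.sub_apply,
    LinearMap.smul_apply, hc.left, map_neg, LinearMap.neg_apply] at e2 e3 e4 e5
  rw [quantize_genComplex_self hf, ← hX, map_smul] at e4
  rw [hs, map_smul, e4] at e2
  rw [hs] at e2 e3
  simp only [map_sub, map_add, map_neg, map_smul]
  have e6 : c x (quantize c k (quantize c k v)) = quantize c k (c x (quantize c k v))
      - c (k x) (quantize c k v) := by rw [e1]; abel
  have e7 : quantize c k (c x (quantize c k v)) = (-(8 / f)) • ((-3 : ℝ) • c (current c B ρ v x) X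
      + c (current c B ρ v x) X) - (-(8 / f)) • c (current c B ρ v (k x)) ρ := by rw [e2]; abel
  have e8 : c (k x) (quantize c k v) = (-(8 / f)) • c (current c B ρ v (k x)) ρ + c x v := by
    rw [e3]; abel
  rw [e6, e7, e8, eq_sub_of_add_eq e5]
  module

/-- Off the plane of ρ and ρ̂ the operator is -σ(K), of square -1. On the plane the correction
replaces ρ ↦ 3ρ̂, ρ̂ ↦ -3ρ by ρ ↦ ρ̂, ρ̂ ↦ -ρ. -/
theorem spinorComplex_spinorComplex [Nontrivial V] (h : IsFierzModule c B S S') (hρ : ρ ∈ S)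
    (hf : f ≠ 0) (hq : cliffordQuartic c B ρ = -3 * f ^ 2) {v : M} (hv : v ∈ S) :
    spinorComplex c B f ρ (spinorComplex c B f ρ v) = -v := by
  have e1 := h.quantize_genComplex_quantize hρ hf hq hv
  have e2 := quantize_genComplex_self (c := c) (B := B) (ρ := ρ) hf
  have e3 := h.quantize_genComplex_hatSpinor hρ hf hq
  have e4 := form_hatSpinor hf hq
  have e5 : ∀ w, B (quantize c (genComplex c B f ρ) v) w
      = -B v (quantize c (genComplex c B f ρ) w) := h.quantize_skew h.genComplex_mem_So v
  have e6 := h.skew ρ (hatSpinor c B f ρ)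
  simp only [spinorComplex, map_add, map_neg, map_smul, LinearMap.add_apply, LinearMap.neg_apply,
    LinearMap.smul_apply, smul_eq_mul, e5, e1, e2, e3, h.alt, e4, e6, h.skew _ v, neg_neg]
  match_scalars <;> field_simp <;> ring

end Negative

end IsFierzModule

/-! ### Recovering the quartic invariant from a conjugate pair -/

section Pure

variable {ρ η : M} {k : Module.End ℝ (Gen V)}

/-- Pair the anticommutator of x and y on ρ with η: only (x, y)⟨ρ, η⟩ survives. -/
theorem IsCliffordModule.eq_zero_of_form_ne_zero (h : IsCliffordModule c B) (hb : B ρ η ≠ 0) {x : Gen V}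
    (h1 : c x ρ = 0) (h2 : c x η = 0) : x = 0 := by
  refine pairing_ext fun y => ?_
  have e := congrArg (B · η) (h.anticomm_apply x y ρ)
  simp only [h1, map_zero, add_zero, map_smul, LinearMap.smul_apply, smul_eq_mul] at e
  rw [h.adj, h2, map_zero, eq_comm, mul_eq_zero, or_iff_left hb] at e
  simpa using e

theorem IsConjugate.apply_apply (h : IsCliffordModule c B) (hb : B ρ η ≠ 0)
    (hc : IsConjugate c ρ η k) (x : Gen V) : k (k x) = -x := by
  rw [eq_neg_iff_add_eq_zero]
  refine h.eq_zero_of_form_ne_zero hb ?_ ?_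
  · rw [map_add, LinearMap.add_apply, hc.left, hc.right, neg_add_cancel]
  · rw [map_add, LinearMap.add_apply, hc.right, hc.left, neg_add_cancel]

/-- Four linear conditions on a space of dimension 2 dim V > 4. They make the complex vector k(z) +
iz orthogonal to x and y. -/
theorem IsConjugate.exists_orthogonal (hV : 2 < Module.finrank ℝ V) (x y : Gen V) :
    ∃ z, z ≠ 0 ∧ pairing V z x = 0 ∧ pairing V z y = 0 ∧
      pairing V (k z) x = 0 ∧ pairing V (k z) y = 0 := by
  let F : Gen V →ₗ[ℝ] Fin 4 → ℝ := LinearMap.pi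
    ![(pairing V).flip x, (pairing V).flip y, (pairing V).flip x ∘ₗ k, (pairing V).flip y ∘ₗ k]
  have hF : LinearMap.ker F ≠ ⊥ := by
    refine LinearMap.ker_ne_bot_of_finrank_lt ?_
    rw [Module.finrank_prod, Subspace.dual_finrank_eq, Module.finrank_fin_fun]
    omega
  obtain ⟨z, hz, hz0⟩ := Submodule.exists_mem_ne_zero_of_ne_bot hF
  have hz' : ∀ i, F z i = 0 := fun i => by rw [LinearMap.mem_ker.1 hz]; rfl
  exact ⟨z, hz0, hz' 0, hz' 1, hz' 2, hz' 3⟩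

/-- The imaginary part of the vanishing of the moment map on pure spinors. -/
theorem IsConjugate.form_eq_neg (hV : 2 < Module.finrank ℝ V) (h : IsCliffordModule c B)
    (hc : IsConjugate c ρ η k) (x y : Gen V) : B (c y ρ) (c x η) = -B (c y η) (c x ρ) := by
  obtain ⟨z, hz, hzx, hzy, hkx, hky⟩ := IsConjugate.exists_orthogonal (k := k) hV x y
  obtain ⟨w, hw⟩ : ∃ w, pairing V z w ≠ 0 := by
    by_contra! hw
    exact hz (pairing_ext fun y => by rw [hw, map_zero, LinearMap.zero_apply])
  -- The factor (u, w) is created by an anticommutator, and c(u) then slides past c(y) and c(x)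
  -- without extra terms. Applied to the complex vector k(z) + iz, which kills φ = ρ + iη, it forces
  -- ⟨c(y)φ, c(x)φ⟩ = 0.
  have key : ∀ u : Gen V, pairing V u x = 0 → pairing V u y = 0 → ∀ α β : M,
      pairing V u w * B (c y α) (c x β)
        = B (c w α) (c y (c x (c u β))) + B (c y (c w (c u α))) (c x β) := by
    intro u hux huy α β
    have e1 := congrArg (fun m => B (c y m) (c x β)) (h.anticomm_apply u w α)
    have e2 := h.anticomm_apply u y (c x β)
    have e3 := h.anticomm_apply u x β
    rw [hux, zero_smul] at e3
    rw [huy, zero_smul, eq_neg_of_add_eq_zero_left e3, map_neg, ← sub_eq_add_neg, sub_eq_zero] at e2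
    simp only [map_add, map_smul, LinearMap.add_apply, LinearMap.smul_apply, smul_eq_mul] at e1
    rw [← e1, h.adj y (c u (c w α)), h.adj u, e2]
  have k1 := key _ hkx hky ρ ρ
  have k2 := key _ hkx hky ρ η
  have k3 := key _ hkx hky η ρ
  have k4 := key _ hkx hky η η
  have l1 := key _ hzx hzy ρ ρ
  have l2 := key _ hzx hzy ρ η
  have l3 := key _ hzx hzy η ρ
  have l4 := key _ hzx hzy η η
  simp only [hc.left, hc.right, map_neg, LinearMap.neg_apply] at k1 k2 k3 k4
  set A := pairing V (k z) w
  set t := pairing V z w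
  -- Two real equations in the real and imaginary parts of ⟨c(y)φ, c(x)φ⟩, with determinant A² + t²
  -- up to sign; it is positive since w was chosen with t ≠ 0.
  have e1 : A * (B (c y ρ) (c x ρ) - B (c y η) (c x η))
      = t * (B (c y ρ) (c x η) + B (c y η) (c x ρ)) := by linarith
  have e2 : t * (B (c y ρ) (c x ρ) - B (c y η) (c x η))
      = -A * (B (c y ρ) (c x η) + B (c y η) (c x ρ)) := by linarith
  have e3 : (A ^ 2 + t ^ 2) * (B (c y ρ) (c x η) + B (c y η) (c x ρ)) = 0 := by
    linear_combination A * e2 - t * e1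
  rw [eq_neg_iff_add_eq_zero]
  exact (mul_eq_zero.1 e3).resolve_left (by positivity)

/-- The vanishing for pure spinors makes ⟨c(y)ρ, c(x)η⟩ symmetric in x and y, so the anticommutator
gives it as half of (x, y)⟨ρ, η⟩. It is also 4(n(kx), y), and k² = -1 inverts the relation. -/
theorem IsConjugate.current_eq (hV : 2 < Module.finrank ℝ V) (h : IsCliffordModule c B)
    (hc : IsConjugate c ρ η k) (hb : B ρ η ≠ 0) (x : Gen V) :
    current c B ρ ρ x = (-(B ρ η / 8)) • k x := by
  have key : ∀ x, current c B ρ ρ (k x) = (B ρ η / 8) • x := fun x => by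
    refine pairing_ext fun y => ?_
    have e1 := hc.form_eq_neg hV h x y
    have e2 := congrArg (B ρ) (h.anticomm_apply y x η)
    rw [map_add, ← h.adj y ρ, ← h.adj x ρ, map_smul, smul_eq_mul, pairing_comm] at e2
    rw [h.skew (c x ρ)] at e2
    rw [pairing_current, hc.left, map_smul, LinearMap.smul_apply, smul_eq_mul]
    linarith
  have e := key (k x)
  rw [hc.apply_apply h hb, map_neg] at e
  rw [neg_smul, ← e, neg_neg]

/-- Up to scale η is a function of ρ alone, which gives uniqueness of the pure spinor. -/
theorem IsConjugate.momentAction_eq (h : IsFierzModule c B S S') (hV : 2 < Module.finrank ℝ V)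
    (hρ : ρ ∈ S) (hc : IsConjugate c ρ η k) (hb : B ρ η ≠ 0) :
    momentAction c B ρ ρ ρ = (3 / 8 * B ρ η) • η := by
  have : Nontrivial V := Module.nontrivial_of_finrank_pos (R := ℝ) (by omega)
  rw [← sub_eq_zero]
  refine h.eq_zero_of_forall fun x => ?_
  rw [map_sub, h.clifford_momentAction hρ, hc.current_eq hV h.toIsCliffordModule hb, map_smul,
    LinearMap.smul_apply, hc.left, map_smul]
  module

theorem IsConjugate.cliffordQuartic_eq (h : IsFierzModule c B S S')
    (hV : 2 < Module.finrank ℝ V) (hρ : ρ ∈ S) (hc : IsConjugate c ρ η k) (hb : B ρ η ≠ 0) :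
    cliffordQuartic c B ρ = -3 * (B ρ η / 2) ^ 2 := by
  rw [cliffordQuartic, hc.momentAction_eq h hV hρ hb, map_smul, LinearMap.smul_apply, smul_eq_mul,
    h.skew]
  ring

end Pure

end Fierz

/-! ### Fock bases and the Fierz identity in dimension six -/

section Fock

variable {V : Type*} [AddCommGroup V] [Module ℝ V]
  {M : Type*} [AddCommGroup M] [Module ℝ M]

variable (V) in
/-- The indices of the standard basis of `V`. -/
abbrev Idx : Type := Fin (Module.finrank ℝ V)

/-- The span of the members of a Fock family of given parity. -/
def fockSpan (m : Finset (Idx V) → M) (r : ZMod 2) : Submodule ℝ M :=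
  Submodule.span ℝ (Set.range fun I : {I : Finset (Idx V) // (I.card : ZMod 2) = r} => m I)

theorem mem_fockSpan (m : Finset (Idx V) → M) (I : Finset (Idx V)) :
    m I ∈ fockSpan m (I.card : ZMod 2) :=
  Submodule.subset_span ⟨⟨I, rfl⟩, rfl⟩

theorem fockSpan_le {m : Finset (Idx V) → M} {r : ZMod 2} {N : Submodule ℝ M}
    (h : ∀ I : Finset (Idx V), (I.card : ZMod 2) = r → m I ∈ N) : fockSpan m r ≤ N := by
  refine Submodule.span_le.2 ?_
  rintro _ ⟨⟨I, hI⟩, rfl⟩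
  exact h I hI

/-- Elements enter in pairs because the available symmetries are products of two vectors. -/
theorem even_finset_induction {α : Type*} [DecidableEq α] {P : Finset α → Prop} (h0 : P ∅)
    (h2 : ∀ I i j, i ∉ I → j ∉ I → i ≠ j → P I → P (insert i (insert j I))) (I : Finset α)
    (hI : (I.card : ZMod 2) = 0) : P I := by
  induction h : I.card using Nat.strong_induction_on generalizing I with
  | _ n ih =>
    rcases I.eq_empty_or_nonempty with rfl | ⟨i, hi⟩
    · exact h0
    · have c1 := Finset.card_erase_add_one hi
      have hI2 : Even I.card := (ZMod.natCast_eq_zero_iff_even).1 hI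
      obtain ⟨j, hj⟩ : (I.erase i).Nonempty := by
        rw [← Finset.card_pos]
        obtain ⟨a, ha⟩ := hI2
        omega
      have c2 := Finset.card_erase_add_one hj
      have hji : j ≠ i := Finset.ne_of_mem_erase hj
      have e : I = insert i (insert j ((I.erase i).erase j)) := by
        rw [Finset.insert_erase hj, Finset.insert_erase hi]
      rw [e]
      refine h2 _ _ _ (by simp) (by simp) hji.symm (ih _ (by omega) _ ?_ rfl)
      rw [ZMod.natCast_eq_zero_iff_even]
      obtain ⟨a, ha⟩ := hI2
      exact ⟨a - 1, by omega⟩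

theorem card_compl_cast (hV : Even (Module.finrank ℝ V)) (I : Finset (Idx V)) :
    (Iᶜ.card : ZMod 2) = I.card := by
  have e := congrArg (Nat.cast (R := ZMod 2)) (Finset.card_compl_add_card I)
  rwa [Fintype.card_fin, Nat.cast_add, (ZMod.natCast_eq_zero_iff_even).2 hV,
    CharTwo.add_eq_zero] at e

variable [FiniteDimensional ℝ V]

/-- Spinors indexed by sets of creation operators applied to a vacuum. -/
structure IsFockFamily (c : Gen V →ₗ[ℝ] Module.End ℝ M) (m : Finset (Idx V) → M) : Prop where
  create_of_mem : ∀ i I, i ∈ I → c (frame V (Sum.inr i)) (m I) = 0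
  annihilate_of_notMem : ∀ i I, i ∉ I → c (frame V (Sum.inl i)) (m I) = 0
  create_of_notMem : ∀ i I, i ∉ I →
    ∃ s : ℝ, s * s = 1 ∧ c (frame V (Sum.inr i)) (m I) = s • m (insert i I)

variable {c : Gen V →ₗ[ℝ] Module.End ℝ M} {B : LinearMap.BilinForm ℝ M}
  {m : Finset (Idx V) → M}

theorem pairing_frame_inl_inr (i : Idx V) :
    pairing V (frame V (Sum.inl i)) (frame V (Sum.inr i)) = 1 := by
  simp [pairing_apply, frame]

theorem pairing_frame_inl_inl (i j : Idx V) :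
    pairing V (frame V (Sum.inl i)) (frame V (Sum.inl j)) = 0 := by
  simp [pairing_apply, frame]

theorem pairing_frame_inr_inr (i j : Idx V) :
    pairing V (frame V (Sum.inr i)) (frame V (Sum.inr j)) = 0 := by
  simp [pairing_apply, frame]

namespace IsFockFamily

theorem annihilate_create (hm : IsFockFamily c m) (h : IsCliffordModule c B) {i : Idx V}
    {I : Finset (Idx V)} (hi : i ∉ I) :
    c (frame V (Sum.inl i)) (c (frame V (Sum.inr i)) (m I)) = m I := by
  have e := h.anticomm_apply (frame V (Sum.inl i)) (frame V (Sum.inr i)) (m I)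
  rwa [hm.annihilate_of_notMem i I hi, map_zero, add_zero, pairing_frame_inl_inr, one_smul] at e

theorem create_annihilate (hm : IsFockFamily c m) (h : IsCliffordModule c B) {i : Idx V}
    {I : Finset (Idx V)} (hi : i ∈ I) :
    c (frame V (Sum.inr i)) (c (frame V (Sum.inl i)) (m I)) = m I := by
  have e := h.anticomm_apply (frame V (Sum.inl i)) (frame V (Sum.inr i)) (m I)
  rwa [hm.create_of_mem i I hi, map_zero, zero_add, pairing_frame_inl_inr, one_smul] at e

theorem annihilate_insert (hm : IsFockFamily c m) (h : IsCliffordModule c B) {i : Idx V}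
    {I : Finset (Idx V)} (hi : i ∉ I) :
    ∃ s : ℝ, s * s = 1 ∧ c (frame V (Sum.inl i)) (m (insert i I)) = s • m I := by
  obtain ⟨s, hs, e⟩ := hm.create_of_notMem i I hi
  refine ⟨s, hs, ?_⟩
  rw [← hm.annihilate_create h hi, e, map_smul, smul_smul, hs, one_smul]

theorem clifford_mem (hm : IsFockFamily c m) (h : IsCliffordModule c B) (x : Gen V) {r : ZMod 2}
    {φ : M} (hφ : φ ∈ fockSpan m r) : c x φ ∈ fockSpan m (r + 1) := by
  refine fockSpan_le (N := (fockSpan m (r + 1)).comap (c x)) (fun I hI => ?_) hφ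
  have e := sum_pairing_frame_swap_map (c.flip (m I)) x
  simp only [LinearMap.flip_apply] at e
  rw [Submodule.mem_comap, ← e]
  refine Submodule.sum_mem _ fun k _ => Submodule.smul_mem _ _ ?_
  rcases k with i | i
  · by_cases hi : i ∈ I
    · obtain ⟨s, hs, e⟩ := hm.annihilate_insert h (Finset.notMem_erase i I)
      rw [Finset.insert_erase hi] at e
      rw [e]
      refine Submodule.smul_mem _ _ ?_
      have : ((I.erase i).card : ZMod 2) = r + 1 := by
        have c1 := congrArg (Nat.cast (R := ZMod 2)) (Finset.card_erase_add_one hi)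
        rw [Nat.cast_add, Nat.cast_one, hI] at c1
        rw [← c1, add_assoc, CharTwo.add_self_eq_zero, add_zero]
      rw [← this]
      exact mem_fockSpan _ _
    · rw [hm.annihilate_of_notMem i I hi]
      exact Submodule.zero_mem _
  · by_cases hi : i ∈ I
    · rw [hm.create_of_mem i I hi]
      exact Submodule.zero_mem _
    · obtain ⟨s, hs, e⟩ := hm.create_of_notMem i I hi
      rw [e]
      refine Submodule.smul_mem _ _ ?_
      have : ((insert i I).card : ZMod 2) = r + 1 := by
        rw [Finset.card_insert_of_notMem hi, Nat.cast_add, Nat.cast_one, hI]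
      rw [← this]
      exact mem_fockSpan _ _

/-- If i lies in both sets or in neither, m I is fixed by a product of creation and annihilation at
i, in one of the two orders. The outer factor moves across the form and kills m J. -/
theorem form_eq_zero (hm : IsFockFamily c m) (h : IsCliffordModule c B) {I J : Finset (Idx V)}
    (hIJ : J ≠ Iᶜ) : B (m I) (m J) = 0 := by
  obtain ⟨i, hi⟩ : ∃ i, ¬(i ∈ J ↔ i ∈ Iᶜ) := by
    by_contra! hc
    exact hIJ (Finset.ext hc)
  rw [Finset.mem_compl] at hi
  by_cases hiI : i ∈ I
  · have hiJ : i ∈ J := by tauto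
    rw [← hm.create_annihilate h hiI, h.adj, hm.create_of_mem i J hiJ, map_zero]
  · have hiJ : i ∉ J := by tauto
    rw [← hm.annihilate_create h hiI, h.adj, hm.annihilate_of_notMem i J hiJ, map_zero]

theorem form_compl_ne_zero (hm : IsFockFamily c m) (h : IsCliffordModule c B)
    (hb : B (m ∅) (m Finset.univ) ≠ 0) (I : Finset (Idx V)) : B (m I) (m Iᶜ) ≠ 0 := by
  induction I using Finset.induction_on with
  | empty => simpa using hb
  | insert i I hi ih =>
    obtain ⟨s, hs, e⟩ := hm.create_of_notMem i I hi
    obtain ⟨t, ht, e'⟩ := hm.create_of_notMem i (insert i I)ᶜ (by simp)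
    have e2 : insert i (insert i I)ᶜ = Iᶜ := by
      ext j
      by_cases hj : j = i <;> simp [hj, hi]
    have e3 := h.adj (frame V (Sum.inr i)) (m I) (m (insert i I)ᶜ)
    rw [e, e', e2, map_smul, map_smul, LinearMap.smul_apply, smul_eq_mul, smul_eq_mul] at e3
    intro hc
    rw [hc, mul_zero, eq_comm, mul_eq_zero] at e3
    rcases e3 with rfl | e3
    · norm_num at ht
    · exact ih e3

/-- Pairing with the complementary index isolates each coefficient; the complement has the same
parity because dim V is even. Linear independence of the family is not presupposed. -/
theorem eq_zero_of_form_eq_zero (hm : IsFockFamily c m) (h : IsCliffordModule c B)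
    (hb : B (m ∅) (m Finset.univ) ≠ 0) (hV : Even (Module.finrank ℝ V)) {r : ZMod 2} {φ : M}
    (hφ : φ ∈ fockSpan m r) (h0 : ∀ ψ ∈ fockSpan m r, B φ ψ = 0) : φ = 0 := by
  obtain ⟨a, rfl⟩ := (Submodule.mem_span_range_iff_exists_fun ℝ).1 hφ
  refine Finset.sum_eq_zero fun I _ => ?_
  have hI := mem_fockSpan m I.1ᶜ
  rw [card_compl_cast hV, I.2] at hI
  have e := h0 _ hI
  rw [map_sum, LinearMap.sum_apply, Finset.sum_eq_single I] at e
  · rw [map_smul, LinearMap.smul_apply, smul_eq_mul, mul_eq_zero] at e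
    rw [e.resolve_right (hm.form_compl_ne_zero h hb I), zero_smul]
  · intro J _ hJ
    rw [map_smul, LinearMap.smul_apply, hm.form_eq_zero h, smul_zero]
    rw [Ne, compl_inj_iff]
    exact fun hc => hJ (Subtype.ext hc.symm)
  · simp

theorem clifford_inl_univ_inl_empty (hm : IsFockFamily c m) (v : V) : c (v, 0) (m ∅) = 0 := by
  have e := sum_pairing_frame_swap_map (c.flip (m ∅)) (v, 0)
  simp only [LinearMap.flip_apply] at e
  rw [← e]
  refine Finset.sum_eq_zero fun k _ => ?_
  rcases k with i | i
  · rw [hm.annihilate_of_notMem i _ (Finset.notMem_empty i), smul_zero]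
  · simp [pairing_apply, frame]

theorem clifford_inr_univ (hm : IsFockFamily c m) (ξ : Module.Dual ℝ V) :
    c (0, ξ) (m Finset.univ) = 0 := by
  have e := sum_pairing_frame_swap_map (c.flip (m Finset.univ)) (0, ξ)
  simp only [LinearMap.flip_apply] at e
  rw [← e]
  refine Finset.sum_eq_zero fun k _ => ?_
  rcases k with i | i
  · simp [pairing_apply, frame]
  · rw [hm.create_of_mem i _ (Finset.mem_univ i), smul_zero]

/-- The vacuum sees only the covector part of x, the top form only the vector part. The symmetrized
current is thus a multiple of the grading element. -/
theorem current_vacuum (hm : IsFockFamily c m) (h : IsCliffordModule c B) (x : Gen V) :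
    (current c B (m Finset.univ) (m ∅) + current c B (m ∅) (m Finset.univ)) x
      = (1 / 4 * B (m ∅) (m Finset.univ)) • ((x.1, -x.2) : Gen V) := by
  refine pairing_ext fun y => ?_
  have e1 : ∀ z : Gen V, c z (m ∅) = c (0, z.2) (m ∅) := fun z => by
    have : z = (z.1, 0) + (0, z.2) := by simp
    conv_lhs => rw [this]
    rw [map_add, LinearMap.add_apply, hm.clifford_inl_univ_inl_empty, zero_add]
  have e2 : ∀ z : Gen V, c z (m Finset.univ) = c (z.1, 0) (m Finset.univ) := fun z => by
    have : z = (z.1, 0) + (0, z.2) := by simp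
    conv_lhs => rw [this]
    rw [map_add, LinearMap.add_apply, hm.clifford_inr_univ, add_zero]
  have e3 : ∀ z w : Gen V, B (c z (m ∅)) (c w (m Finset.univ))
      = z.2 w.1 * B (m ∅) (m Finset.univ) := fun z w => by
    have e := congrArg (B (m ∅)) (h.anticomm_apply (0, z.2) (w.1, 0) (m Finset.univ))
    rw [hm.clifford_inr_univ, map_zero, add_zero, ← h.adj, ← e1, ← e2, map_smul] at e
    rw [e]
    simp [pairing_apply]
  rw [LinearMap.add_apply, map_add, LinearMap.add_apply, pairing_current, pairing_current,
    h.skew (c y (m Finset.univ)), e3, e3, map_smul, LinearMap.smul_apply]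
  simp [pairing_apply]
  ring

/-- Quantizing the grading element yields the number operator, centred by the symmetric ordering. -/
theorem quantize_vacuum (hm : IsFockFamily c m) (h : IsCliffordModule c B)
    (I : Finset (Idx V)) :
    quantize c (current c B (m Finset.univ) (m ∅) + current c B (m ∅) (m Finset.univ)) (m I)
      = (1 / 8 * B (m ∅) (m Finset.univ) * (Module.finrank ℝ V - 2 * I.card)) • m I := by
  have e1 : ∀ i, c (frame V (Sum.inl i)) (c (frame V (Sum.inr i)) (m I))
      = (if i ∈ I then (0 : ℝ) else 1) • m I := fun i => by
    split_ifs with hi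
    · rw [hm.create_of_mem i I hi, map_zero, zero_smul]
    · rw [hm.annihilate_create h hi, one_smul]
  have e2 : ∀ i, c (frame V (Sum.inr i)) (c (frame V (Sum.inl i)) (m I))
      = (if i ∈ I then (1 : ℝ) else 0) • m I := fun i => by
    split_ifs with hi
    · rw [hm.create_annihilate h hi, one_smul]
    · rw [hm.annihilate_of_notMem i I hi, map_zero, zero_smul]
  have e3 : ∀ i, (((frame V (Sum.inl i)).1, -(frame V (Sum.inl i)).2) : Gen V)
      = frame V (Sum.inl i) := fun i => by simp [frame]
  have e4 : ∀ i, (((frame V (Sum.inr i)).1, -(frame V (Sum.inr i)).2) : Gen V)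
      = -frame V (Sum.inr i) := fun i => by simp [frame]
  rw [quantize_apply, Fintype.sum_sum_type]
  simp only [hm.current_vacuum h, e3, e4, map_smul, map_neg, Sum.swap_inl, Sum.swap_inr,
    LinearMap.smul_apply, LinearMap.add_apply, LinearMap.sum_apply, Module.End.mul_apply,
    LinearMap.neg_apply, e1, e2]
  rw [← Finset.sum_add_distrib]
  have e5 : ∀ i : Idx V, (1 / 4 * B (m ∅) (m Finset.univ)) • (if i ∈ I then (0 : ℝ) else 1) • m I
      + (1 / 4 * B (m ∅) (m Finset.univ)) • -((if i ∈ I then (1 : ℝ) else 0) • m I)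
      = (1 / 4 * B (m ∅) (m Finset.univ) * (1 - 2 * if i ∈ I then (1 : ℝ) else 0)) • m I := by
    intro i
    split_ifs <;> module
  rw [Finset.sum_congr rfl fun i _ => e5 i, ← Finset.sum_smul, ← Finset.mul_sum,
    Finset.sum_sub_distrib, ← Finset.mul_sum, smul_smul]
  congr 1
  simp
  ring

/-- A term survives only if annihilating i turns m I into a multiple of the vacuum, so I is a
singleton. In the companion statement creation must reach the top form. -/
theorem exchange_vacuum (hm : IsFockFamily c m) (h : IsCliffordModule c B)
    (I : Finset (Idx V)) : exchange c B (m Finset.univ) (m ∅) (m I)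
      = (if I.card = 1 then -B (m ∅) (m Finset.univ) else 0) • m I := by
  rw [exchange_apply, Fintype.sum_sum_type, Finset.sum_eq_zero (s := Finset.univ)
    (f := fun i => B _ (c (frame V (Sum.inr i)) _) • _), add_zero]
  · split_ifs with hI
    · obtain ⟨j, rfl⟩ := Finset.card_eq_one.1 hI
      rw [Finset.sum_eq_single j]
      · obtain ⟨s, hs, e⟩ := hm.create_of_notMem j ∅ (Finset.notMem_empty j)
        have e2 := hm.annihilate_create h (Finset.notMem_empty j)
        rw [insert_empty_eq] at e
        rw [Sum.swap_inl, e, smul_smul, mul_comm, ← smul_eq_mul, ← map_smul, ← map_smul, ← e, e2,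
          h.skew]
      · intro i _ hij
        rw [hm.annihilate_of_notMem i _ (by simpa using hij), map_zero, zero_smul]
      · simp
    · rw [zero_smul]
      refine Finset.sum_eq_zero fun i _ => ?_
      by_cases hi : i ∈ I
      · obtain ⟨s, hs, e⟩ := hm.annihilate_insert h (Finset.notMem_erase i I)
        rw [Finset.insert_erase hi] at e
        rw [e, map_smul, hm.form_eq_zero h, smul_zero, zero_smul]
        rw [Finset.compl_univ]
        intro hc
        have := Finset.card_erase_add_one hi
        rw [hc, Finset.card_empty] at this
        exact hI this.symm
      · rw [hm.annihilate_of_notMem i _ hi, map_zero, zero_smul]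
  · intro i _
    rw [Sum.swap_inr, hm.annihilate_of_notMem i _ (Finset.notMem_empty i), smul_zero]

theorem exchange_vacuum' (hm : IsFockFamily c m) (h : IsCliffordModule c B)
    (I : Finset (Idx V)) : exchange c B (m ∅) (m Finset.univ) (m I)
      = (if I.card + 1 = Module.finrank ℝ V then B (m ∅) (m Finset.univ) else 0) • m I := by
  rw [exchange_apply, Fintype.sum_sum_type, Finset.sum_eq_zero (s := Finset.univ)
    (f := fun i => B _ (c (frame V (Sum.inl i)) _) • _), zero_add]
  · split_ifs with hI
    · have hI' : Iᶜ.card = 1 := by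
        rw [Finset.card_compl, Fintype.card_fin]
        omega
      obtain ⟨j, hj⟩ := Finset.card_eq_one.1 hI'
      have hjI : j ∉ I := by
        rw [← Finset.mem_compl, hj, Finset.mem_singleton]
      have hins : insert j I = Finset.univ := by
        rw [← compl_inj_iff, Finset.compl_univ, Finset.compl_insert, hj]
        simp
      rw [Finset.sum_eq_single j]
      · obtain ⟨s, hs, e⟩ := hm.create_of_notMem j I hjI
        have e2 := hm.annihilate_create h hjI
        rw [hins] at e
        rw [e, map_smul] at e2
        rw [Sum.swap_inr, e, map_smul, smul_eq_mul, mul_comm, mul_smul, e2]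
      · intro i _ hij
        have hi : i ∈ I := by
          by_contra hi
          rw [← Finset.mem_compl, hj, Finset.mem_singleton] at hi
          exact hij hi
        rw [hm.create_of_mem i _ hi, map_zero, zero_smul]
      · simp
    · rw [zero_smul]
      refine Finset.sum_eq_zero fun i _ => ?_
      by_cases hi : i ∈ I
      · rw [hm.create_of_mem i _ hi, map_zero, zero_smul]
      · obtain ⟨s, hs, e⟩ := hm.create_of_notMem i I hi
        rw [e, map_smul, hm.form_eq_zero h, smul_zero, zero_smul]
        rw [Finset.compl_empty]
        intro hc
        have := Finset.card_insert_of_notMem hi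
        rw [hc, Finset.card_univ, Fintype.card_fin] at this
        exact hI this.symm
  · intro i _
    rw [Sum.swap_inl, hm.create_of_mem i _ (Finset.mem_univ i), smul_zero]

/-- Dimension six enters here. With b = ⟨m ∅, m univ⟩, the exchange terms are -b, 0, b on forms of
degree 1, 3, 5, and the doubled number operator (b/4)(6 - 2|I|) is b, 0, -b there. -/
theorem fierzDefect_vacuum (hV : Module.finrank ℝ V = 6) (hm : IsFockFamily c m)
    (h : IsCliffordModule c B) {χ : M} (hχ : χ ∈ fockSpan m 1) :
    fierzDefect c B (m Finset.univ) (m ∅) χ = 0 := by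
  refine fockSpan_le (N := LinearMap.ker (fierzDefect c B (m Finset.univ) (m ∅)))
    (fun I hI => ?_) hχ
  have hodd : Odd I.card := (ZMod.natCast_eq_one_iff_odd).1 hI
  have hle : I.card ≤ 6 := hV ▸ (Finset.card_le_univ I).trans_eq (Fintype.card_fin _)
  rw [LinearMap.mem_ker, fierzDefect_apply, ← map_add]
  simp only [LinearMap.add_apply, LinearMap.smul_apply, hm.exchange_vacuum h,
    hm.exchange_vacuum' h, hm.quantize_vacuum h, hV]
  generalize hn : I.card = n at *
  interval_cases n
  · simp at hodd
  · norm_num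
    module
  · exact absurd hodd (by decide)
  · norm_num
  · exact absurd hodd (by decide)
  · norm_num
    module
  · exact absurd hodd (by decide)

/-- Equivariance transfers c(x)c(y) from the first spinor to the second. Choosing the second spinor
as the vacuum, and x, y as annihilators, makes the transferred term vanish. -/
theorem fierzDefect_eq_zero (hV : Module.finrank ℝ V = 6) (hm : IsFockFamily c m)
    (h : IsCliffordModule c B) {ρ ρ' χ : M} (hρ : ρ ∈ fockSpan m 0) (hρ' : ρ' ∈ fockSpan m 0)
    (hχ : χ ∈ fockSpan m 1) : fierzDefect c B ρ ρ' χ = 0 := by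
  have hmem : ∀ x y : Gen V, ∀ χ ∈ fockSpan m 1, c x (c y χ) ∈ fockSpan m 1 :=
    fun x y χ hχ => by
      have := hm.clifford_mem h x (hm.clifford_mem h y hχ)
      rwa [add_assoc, CharTwo.add_self_eq_zero, add_zero] at this
  have step : ∀ (x y : Gen V), pairing V x y = 0 → ∀ ρ ρ' : M,
      (∀ χ ∈ fockSpan m 1, fierzDefect c B ρ ρ' χ = 0) →
      (∀ χ ∈ fockSpan m 1, fierzDefect c B ρ (c x (c y ρ')) χ = 0) →
      ∀ χ ∈ fockSpan m 1, fierzDefect c B (c x (c y ρ)) ρ' χ = 0 := by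
    intro x y hxy ρ ρ' h1 h2 χ hχ
    have e := LinearMap.congr_fun (h.fierzDefect_clifford_mul hxy ρ ρ') χ
    simpa [h1 χ hχ, h2 χ hχ, h1 _ (hmem x y χ hχ)] using e
  -- Pairs of annihilators descend from the top form to every even member while killing the vacuum
  -- in the second slot. The induction runs over the complement of I.
  have vac : ∀ I : Finset (Idx V), (I.card : ZMod 2) = 0 →
      ∀ χ ∈ fockSpan m 1, fierzDefect c B (m I) (m ∅) χ = 0 := by
    intro I hI
    have hc : ((Iᶜ).card : ZMod 2) = 0 := by
      rw [card_compl_cast (hV ▸ by decide), hI]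
    rw [← compl_compl I]
    refine even_finset_induction (P := fun J => ∀ χ ∈ fockSpan m 1,
      fierzDefect c B (m Jᶜ) (m ∅) χ = 0) ?_ ?_ _ hc
    · rw [Finset.compl_empty]
      exact fun χ hχ => hm.fierzDefect_vacuum hV h hχ
    · intro J i j hi hj hij ih
      set K := (insert i (insert j J))ᶜ with hK
      have hiK : i ∉ K := by simp [hK]
      have hjK : j ∉ insert i K := by simp [hK, hij.symm]
      have hJK : insert j (insert i K) = Jᶜ := by
        ext a
        by_cases h1 : a = i <;> by_cases h2 : a = j <;> simp [hK, h1, h2, hi, hj]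
      obtain ⟨s, hs, e1⟩ := hm.annihilate_insert h hiK
      obtain ⟨t, ht, e2⟩ := hm.annihilate_insert h hjK
      rw [hJK] at e2
      have e3 : m K = (s * t) • c (frame V (Sum.inl i)) (c (frame V (Sum.inl j)) (m Jᶜ)) := by
        rw [e2, map_smul, e1, smul_smul, smul_smul]
        have : s * t * t * s = 1 := by linear_combination s * s * ht + hs
        rw [this, one_smul]
      intro χ hχ
      rw [e3, map_smul, LinearMap.smul_apply, LinearMap.smul_apply,
        step _ _ (pairing_frame_inl_inl i j) _ _ ih ?_ χ hχ, smul_zero]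
      intro χ _
      rw [hm.annihilate_of_notMem j _ (Finset.notMem_empty j), map_zero, map_zero,
        LinearMap.zero_apply]
  -- Pairs of creators now build up the first slot from the vacuum. The second slot ranges over all
  -- even spinors, so that the inductive hypothesis covers the transferred term.
  have all : ∀ J : Finset (Idx V), (J.card : ZMod 2) = 0 →
      ∀ ρ ∈ fockSpan m 0, ∀ χ ∈ fockSpan m 1, fierzDefect c B (m J) ρ χ = 0 := by
    intro J hJ
    refine even_finset_induction (P := fun J => ∀ ρ ∈ fockSpan m 0, ∀ χ ∈ fockSpan m 1,
      fierzDefect c B (m J) ρ χ = 0) ?_ ?_ J hJ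
    · intro ρ hρ χ hχ
      rw [fierzDefect_comm]
      exact fockSpan_le (N := LinearMap.ker (((fierzDefect c B).flip (m ∅)).flip χ))
        (fun I hI => vac I hI χ hχ) hρ
    · intro I i j hi hj hij ih ρ hρ
      obtain ⟨s, hs, e1⟩ := hm.create_of_notMem j I hj
      obtain ⟨t, ht, e2⟩ := hm.create_of_notMem i (insert j I) (by simp [hi, hij])
      have e3 : m (insert i (insert j I))
          = (s * t) • c (frame V (Sum.inr i)) (c (frame V (Sum.inr j)) (m I)) := by
        rw [e1, map_smul, e2, smul_smul, smul_smul]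
        have : s * t * s * t = 1 := by linear_combination s * s * ht + hs
        rw [this, one_smul]
      intro χ hχ
      rw [e3, map_smul, LinearMap.smul_apply, LinearMap.smul_apply,
        step _ _ (pairing_frame_inr_inr i j) _ _ (ih ρ hρ) (ih _ ?_) χ hχ, smul_zero]
      have := hm.clifford_mem h (frame V (Sum.inr i))
        (hm.clifford_mem h (frame V (Sum.inr j)) hρ)
      rwa [add_assoc, CharTwo.add_self_eq_zero, add_zero] at this
  exact fockSpan_le (N := LinearMap.ker (((fierzDefect c B).flip ρ').flip χ))
    (fun I hI => all I hI ρ' hρ' χ hχ) hρ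

theorem isFierzModule (hV : Module.finrank ℝ V = 6) (hm : IsFockFamily c m)
    (h : IsCliffordModule c B) : IsFierzModule c B (fockSpan m 0) (fockSpan m 1) where
  toIsCliffordModule := h
  map_even x φ hφ := by simpa using hm.clifford_mem h x hφ
  map_odd x φ hφ := by
    have := hm.clifford_mem h x hφ
    rwa [CharTwo.add_self_eq_zero] at this
  fierz ρ hρ ρ' hρ' χ hχ := hm.fierzDefect_eq_zero hV h hρ hρ' hχ

end IsFockFamily

end Fock

/-! ### The Clifford module `Λ*V*` -/

section Exterior

variable {V : Type*} [AddCommGroup V] [Module ℝ V]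

theorem clifford_inl (v : V) (φ : Forms V) : clifford V (v, 0) φ
    = CliffordAlgebra.contractLeft (Q := (0 : QuadraticForm ℝ (Module.Dual ℝ V)))
      (Module.Dual.eval ℝ V v) φ := by
  simp [clifford]

theorem clifford_inr (ξ : Module.Dual ℝ V) (φ : Forms V) :
    clifford V (0, ξ) φ = ExteriorAlgebra.ι ℝ ξ * φ := by
  simp [clifford]

theorem clifford_anticomm (x y : Gen V) :
    clifford V x * clifford V y + clifford V y * clifford V x
      = pairing V x y • (1 : Module.End ℝ (Forms V)) := by
  apply LinearMap.ext
  intro φ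
  have h0 := congrArg (· * φ) (ExteriorAlgebra.ι_add_mul_swap (R := ℝ) x.2 y.2)
  have h1 := CliffordAlgebra.contractLeft_comm (Q := (0 : QuadraticForm ℝ (Module.Dual ℝ V)))
    (Module.Dual.eval ℝ V x.1) (Module.Dual.eval ℝ V y.1) φ
  simp only [add_mul, mul_assoc, zero_mul] at h0
  simp only [clifford, LinearMap.add_apply, Module.End.mul_apply, LinearMap.coprod_apply,
    LinearMap.comp_apply, LinearMap.mul_apply', mul_add, LinearMap.smul_apply,
    Module.End.one_apply, add_smul, pairing_apply]
  rw [h1]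
  erw [CliffordAlgebra.contractLeft_ι_mul, CliffordAlgebra.contractLeft_ι_mul]
  simp only [Module.Dual.eval_apply]
  rw [eq_neg_of_add_eq_zero_left h0]
  abel

theorem clifford_inl_mul (v : V) (ξ : Module.Dual ℝ V) (φ : Forms V) :
    clifford V (v, 0) (ExteriorAlgebra.ι ℝ ξ * φ)
      = ξ v • φ - ExteriorAlgebra.ι ℝ ξ * clifford V (v, 0) φ := by
  have e := LinearMap.congr_fun (clifford_anticomm (v, 0) (0, ξ)) φ
  simp only [LinearMap.add_apply, Module.End.mul_apply, clifford_inr, LinearMap.smul_apply,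
    Module.End.one_apply, pairing_apply] at e
  rw [eq_sub_iff_add_eq, e]
  simp

theorem clifford_inl_one (v : V) : clifford V (v, 0) 1 = 0 := by
  rw [clifford_inl]
  exact CliffordAlgebra.contractLeft_one (Q := (0 : QuadraticForm ℝ (Module.Dual ℝ V)))
    (Module.Dual.eval ℝ V v)

theorem reverse_ι_mul (ξ : Module.Dual ℝ V) (φ : Forms V) :
    CliffordAlgebra.reverse (Q := (0 : QuadraticForm ℝ (Module.Dual ℝ V)))
      (ExteriorAlgebra.ι ℝ ξ * φ)
      = CliffordAlgebra.reverse (Q := (0 : QuadraticForm ℝ (Module.Dual ℝ V))) φ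
        * ExteriorAlgebra.ι ℝ ξ := by
  rw [CliffordAlgebra.reverse.map_mul]
  congr 1
  exact CliffordAlgebra.reverse_ι _

theorem sigmaWedge_apply (φ ψ : Forms V) : sigmaWedge V φ ψ
    = CliffordAlgebra.reverse (Q := (0 : QuadraticForm ℝ (Module.Dual ℝ V))) φ * ψ := rfl

theorem topPairing_eq_zero {k : ℕ} {φ : Forms V} (hφ : φ ∈ ⋀[ℝ]^k (Module.Dual ℝ V))
    (hk : k ≠ 6) : topPairing V φ = 0 := by
  have e : DirectSum.component ℝ ℕ (fun i => ⋀[ℝ]^i (Module.Dual ℝ V)) 6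
      (DirectSum.decomposeLinearEquiv (fun i => ⋀[ℝ]^i (Module.Dual ℝ V)) φ) = 0 :=
    Subtype.ext (DirectSum.decompose_of_mem_ne (fun i => ⋀[ℝ]^i (Module.Dual ℝ V)) hφ hk)
  rw [topPairing, LinearMap.comp_apply, LinearMap.comp_apply, LinearEquiv.coe_coe, e, map_zero]

theorem topPairing_of_mem (φ : ⋀[ℝ]^6 (Module.Dual ℝ V)) :
    topPairing V (φ : Forms V) = exteriorPower.pairingDual ℝ V 6 φ := by
  have e : DirectSum.component ℝ ℕ (fun i => ⋀[ℝ]^i (Module.Dual ℝ V)) 6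
      (DirectSum.decomposeLinearEquiv (fun i => ⋀[ℝ]^i (Module.Dual ℝ V)) (φ : Forms V)) = φ :=
    Subtype.ext (DirectSum.decompose_of_mem_same (fun i => ⋀[ℝ]^i (Module.Dual ℝ V)) φ.2)
  rw [topPairing, LinearMap.comp_apply, LinearMap.comp_apply, LinearEquiv.coe_coe, e]

variable [FiniteDimensional ℝ V]

/-- The product of a list of basis covectors. -/
def basisWord (l : List (Idx V)) : Forms V :=
  (l.map fun i => ExteriorAlgebra.ι ℝ ((Module.finBasis ℝ V).coord i)).prod

/-- The product of a set of basis covectors, in some order. -/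
def basisForm (I : Finset (Idx V)) : Forms V := basisWord I.toList

theorem basisWord_cons (i : Idx V) (l : List (Idx V)) :
    basisWord (i :: l) = ExteriorAlgebra.ι ℝ ((Module.finBasis ℝ V).coord i) * basisWord l := by
  simp [basisWord]

theorem basisWord_mem (l : List (Idx V)) : basisWord l ∈ ⋀[ℝ]^l.length (Module.Dual ℝ V) := by
  induction l with
  | nil => simp [basisWord]
  | cons i l ih =>
    rw [basisWord_cons, List.length_cons, ExteriorAlgebra.exteriorPower, pow_succ']
    exact Submodule.mul_mem_mul (LinearMap.mem_range_self _ _) ih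

theorem basisWord_mem_evenOdd (l : List (Idx V)) : basisWord l ∈
    CliffordAlgebra.evenOdd (0 : QuadraticForm ℝ (Module.Dual ℝ V)) (l.length : ZMod 2) := by
  induction l with
  | nil => simpa [basisWord] using SetLike.GradedOne.one_mem
  | cons i l ih =>
    rw [basisWord_cons, List.length_cons, Nat.cast_add, Nat.cast_one, add_comm]
    exact SetLike.mul_mem_graded (CliffordAlgebra.ι_mem_evenOdd_one _ _) ih

/-- Keeping only s² = 1 frees the Fock family from any ordering of the indices: the arbitrary order
of `Finset.toList` is harmless. -/
theorem basisWord_perm {l l' : List (Idx V)} (h : l.Perm l') :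
    ∃ s : ℝ, s * s = 1 ∧ basisWord l = s • basisWord l' := by
  induction h with
  | nil => exact ⟨1, by norm_num, by simp⟩
  | cons i _ ih =>
    obtain ⟨s, hs, e⟩ := ih
    exact ⟨s, hs, by rw [basisWord_cons, basisWord_cons, e, mul_smul_comm]⟩
  | swap i j l =>
    refine ⟨-1, by norm_num, ?_⟩
    have e := ExteriorAlgebra.ι_add_mul_swap (R := ℝ) ((Module.finBasis ℝ V).coord j)
      ((Module.finBasis ℝ V).coord i)
    rw [basisWord_cons, basisWord_cons, basisWord_cons, basisWord_cons, ← mul_assoc, ← mul_assoc,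
      eq_neg_of_add_eq_zero_left e, neg_mul, neg_one_smul]
  | trans _ _ ih ih' =>
    obtain ⟨s, hs, e⟩ := ih
    obtain ⟨t, ht, e'⟩ := ih'
    exact ⟨s * t, by linear_combination s * s * ht + hs, by rw [e, e', smul_smul]⟩

theorem basisForm_insert {i : Idx V} {I : Finset (Idx V)} (hi : i ∉ I) :
    ∃ s : ℝ, s * s = 1 ∧ ExteriorAlgebra.ι ℝ ((Module.finBasis ℝ V).coord i) * basisForm I
      = s • basisForm (insert i I) := by
  obtain ⟨s, hs, e⟩ := basisWord_perm (Finset.toList_insert hi).symm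
  exact ⟨s, hs, by rw [basisForm, basisForm, ← e, basisWord_cons]⟩

theorem isFockFamily_basisForm : IsFockFamily (clifford V) (basisForm (V := V)) where
  create_of_mem i I hi := by
    obtain ⟨s, hs, e⟩ := basisForm_insert (Finset.notMem_erase i I)
    rw [Finset.insert_erase hi] at e
    have e2 := congrArg (fun z => s • (ExteriorAlgebra.ι ℝ ((Module.finBasis ℝ V).coord i) * z)) e
    simp only [mul_smul_comm, smul_smul, hs, one_smul, ← mul_assoc, ExteriorAlgebra.ι_sq_zero,
      zero_mul, smul_zero] at e2
    rw [frame, Sum.elim_inr, clifford_inr, e2]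
  annihilate_of_notMem i I hi := by
    rw [frame, Sum.elim_inl, basisForm]
    have hi' : i ∉ I.toList := by simpa using hi
    generalize I.toList = l at hi'
    induction l with
    | nil => simpa [basisWord] using clifford_inl_one _
    | cons j l ih =>
      rw [List.mem_cons, not_or] at hi'
      rw [basisWord_cons, clifford_inl_mul, ih hi'.2]
      simp [Ne.symm hi'.1]
  create_of_notMem i I hi := by
    obtain ⟨s, hs, e⟩ := basisForm_insert hi
    exact ⟨s, hs, by rw [frame, Sum.elim_inr, clifford_inr, e]⟩

theorem span_basisForm : Submodule.span ℝ (Set.range (basisForm (V := V))) = ⊤ := by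
  rw [eq_top_iff]
  rintro φ -
  induction φ using CliffordAlgebra.left_induction with
  | algebraMap r =>
    rw [Algebra.algebraMap_eq_smul_one]
    exact Submodule.smul_mem _ _ (Submodule.subset_span ⟨∅, by simp [basisForm, basisWord]⟩)
  | add φ ψ hφ hψ => exact Submodule.add_mem _ hφ hψ
  | ι_mul φ ξ hφ =>
    have h1 : ∀ i, ∀ φ ∈ Submodule.span ℝ (Set.range (basisForm (V := V))),
        clifford V (frame V (Sum.inr i)) φ ∈ Submodule.span ℝ (Set.range (basisForm (V := V))) := by
      intro i φ hφ
      refine (Submodule.span_le (p := (Submodule.span ℝ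
        (Set.range (basisForm (V := V)))).comap (clifford V (frame V (Sum.inr i))))).2 ?_ hφ
      rintro _ ⟨I, rfl⟩
      rw [SetLike.mem_coe, Submodule.mem_comap]
      by_cases hi : i ∈ I
      · rw [isFockFamily_basisForm.create_of_mem i I hi]
        exact Submodule.zero_mem _
      · obtain ⟨s, hs, e⟩ := isFockFamily_basisForm.create_of_notMem i I hi
        rw [e]
        exact Submodule.smul_mem _ _ (Submodule.subset_span ⟨_, rfl⟩)
    have e := sum_pairing_frame_swap_map ((clifford V).flip φ) (0, ξ)
    simp only [LinearMap.flip_apply, clifford_inr] at e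
    change ExteriorAlgebra.ι ℝ ξ * φ ∈ _
    rw [← e]
    refine Submodule.sum_mem _ fun k _ => ?_
    rcases k with i | i
    · simp [pairing_apply, frame]
    · exact Submodule.smul_mem _ _ (h1 i φ hφ)

theorem eq_zero_of_basisForm {N : Type*} [AddCommGroup N] [Module ℝ N] {f : Forms V →ₗ[ℝ] N}
    (hf : ∀ I, f (basisForm I) = 0) : f = 0 := by
  refine LinearMap.ext_on span_basisForm ?_
  rintro _ ⟨I, rfl⟩
  exact hf I

/-- For the empty word the truncated exponent is 0, which is harmless since the contraction of 1 is
0. -/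
theorem clifford_basisWord_mem (v : V) (l : List (Idx V)) :
    clifford V (v, 0) (basisWord l) ∈ ⋀[ℝ]^(l.length - 1) (Module.Dual ℝ V) := by
  induction l with
  | nil =>
    have : basisWord (V := V) [] = 1 := by simp [basisWord]
    rw [this, clifford_inl_one]
    exact Submodule.zero_mem _
  | cons i l ih =>
    rw [basisWord_cons, clifford_inl_mul, List.length_cons, Nat.add_sub_cancel]
    refine Submodule.sub_mem _ (Submodule.smul_mem _ _ (basisWord_mem l)) ?_
    rcases l with _ | ⟨j, l⟩
    · have : basisWord (V := V) [] = 1 := by simp [basisWord]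
      rw [this, clifford_inl_one, mul_zero]
      exact Submodule.zero_mem _
    · rw [List.length_cons, ExteriorAlgebra.exteriorPower, pow_succ']
      exact Submodule.mul_mem_mul (LinearMap.mem_range_self _ _) ih

theorem topPairing_contract (hV : Module.finrank ℝ V = 6) (v : V) (φ : Forms V) :
    topPairing V (clifford V (v, 0) φ) = 0 := by
  suffices h : topPairing V ∘ₗ clifford V (v, 0) = 0 from LinearMap.congr_fun h φ
  refine eq_zero_of_basisForm fun I => ?_
  refine topPairing_eq_zero (clifford_basisWord_mem v I.toList) ?_
  have := hV ▸ (Finset.card_le_univ I).trans_eq (Fintype.card_fin _)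
  rw [Finset.length_toList]
  omega

/-- For covectors this is associativity and reversal. For vectors, contraction is an antiderivation
and a contracted form has no component of degree six; the induction peels one-forms off φ and moves
them to ψ. -/
theorem topPairing_clifford (hV : Module.finrank ℝ V = 6) (x : Gen V) (φ ψ : Forms V) :
    topPairing V (sigmaWedge V (clifford V x φ) ψ)
      = topPairing V (sigmaWedge V φ (clifford V x ψ)) := by
  have h1 : topPairing V (sigmaWedge V (clifford V (x.1, 0) φ) ψ)
      = topPairing V (sigmaWedge V φ (clifford V (x.1, 0) ψ)) := by
    induction φ using CliffordAlgebra.left_induction generalizing ψ with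
    | algebraMap r =>
      rw [Algebra.algebraMap_eq_smul_one]
      change topPairing V (sigmaWedge V (clifford V (x.1, 0) (r • (1 : Forms V))) ψ) = _
      rw [map_smul, clifford_inl_one, smul_zero, map_zero, LinearMap.zero_apply, map_zero, map_smul,
        LinearMap.smul_apply, sigmaWedge_apply, CliffordAlgebra.reverse.map_one, one_mul, map_smul,
        topPairing_contract hV, smul_zero]
    | add φ φ' h h' =>
      rw [map_add, map_add, LinearMap.add_apply, map_add, h, h', map_add, LinearMap.add_apply,
        map_add]
    | ι_mul φ ξ h =>
      have e1 := h (ExteriorAlgebra.ι ℝ ξ * ψ)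
      change topPairing V (sigmaWedge V (clifford V (x.1, 0) (ExteriorAlgebra.ι ℝ ξ * φ)) ψ)
        = topPairing V (sigmaWedge V (ExteriorAlgebra.ι ℝ ξ * φ) (clifford V (x.1, 0) ψ))
      simp only [sigmaWedge_apply, clifford_inl_mul] at e1 ⊢
      simp only [map_sub, map_smul, reverse_ι_mul, mul_sub, sub_mul, mul_assoc, mul_smul_comm,
        smul_mul_assoc] at e1 ⊢
      rw [e1]
      abel
  have h2 : sigmaWedge V (clifford V (0, x.2) φ) ψ = sigmaWedge V φ (clifford V (0, x.2) ψ) := by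
    simp only [sigmaWedge_apply, clifford_inr, reverse_ι_mul, mul_assoc]
  have h3 : x = (x.1, 0) + (0, x.2) := by simp
  rw [h3]
  simp only [map_add, LinearMap.add_apply, h1, h2]

theorem basisWord_mul_ι (l : List (Idx V)) (ξ : Module.Dual ℝ V) :
    basisWord l * ExteriorAlgebra.ι ℝ ξ
      = (-1 : ℝ) ^ l.length • (ExteriorAlgebra.ι ℝ ξ * basisWord l) := by
  induction l with
  | nil => simp [basisWord]
  | cons i l ih =>
    have e := ExteriorAlgebra.ι_add_mul_swap (R := ℝ) ((Module.finBasis ℝ V).coord i) ξ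
    rw [basisWord_cons, mul_assoc, ih, mul_smul_comm, ← mul_assoc,
      eq_neg_of_add_eq_zero_left e, neg_mul, mul_assoc, List.length_cons, pow_succ, mul_neg_one,
      neg_smul, smul_neg]

theorem reverse_basisWord (l : List (Idx V)) :
    CliffordAlgebra.reverse (Q := (0 : QuadraticForm ℝ (Module.Dual ℝ V))) (basisWord l)
      = (-1 : ℝ) ^ (l.length * (l.length - 1) / 2) • basisWord l := by
  induction l with
  | nil => simp [basisWord]
  | cons i l ih =>
    rw [basisWord_cons, reverse_ι_mul, ih, smul_mul_assoc, basisWord_mul_ι, smul_smul, ← pow_add,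
      List.length_cons, Nat.triangle_succ]

/-- Reversing six one-forms has sign (-1)^15. This is why the spinor form is alternating. -/
theorem topPairing_reverse (φ : Forms V) :
    topPairing V (CliffordAlgebra.reverse (Q := (0 : QuadraticForm ℝ (Module.Dual ℝ V))) φ)
      = -topPairing V φ := by
  suffices h : topPairing V ∘ₗ CliffordAlgebra.reverse
      (Q := (0 : QuadraticForm ℝ (Module.Dual ℝ V))) + topPairing V = 0 from
    eq_neg_of_add_eq_zero_left (LinearMap.congr_fun h φ)
  refine eq_zero_of_basisForm fun I => ?_
  rw [LinearMap.add_apply, LinearMap.comp_apply, basisForm, reverse_basisWord, map_smul]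
  by_cases h : I.toList.length = 6
  · have e : (-1 : ℝ) ^ (6 * (6 - 1) / 2) = -1 := by norm_num
    rw [h, e]
    refine LinearMap.ext fun w => ?_
    change -1 * topPairing V (basisWord I.toList) w + topPairing V (basisWord I.toList) w = 0
    ring
  · rw [topPairing_eq_zero (basisWord_mem _) h, smul_zero, add_zero]

theorem topPairing_sigmaWedge_self (φ : Forms V) : topPairing V (sigmaWedge V φ φ) = 0 := by
  have e := topPairing_reverse (sigmaWedge V φ φ)
  rw [sigmaWedge_apply, CliffordAlgebra.reverse.map_mul, CliffordAlgebra.reverse_reverse] at e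
  rw [sigmaWedge_apply]
  refine LinearMap.ext fun w => ?_
  have ew := LinearMap.congr_fun e w
  rw [LinearMap.neg_apply] at ew
  rw [LinearMap.zero_apply]
  linarith

/-- All other basis forms have degree below six, so vanishing here would make every pairing with w
vanish. But w spans Λ⁶V, and the product of a basis pairs to 1 with that of its dual basis. -/
theorem topPairing_basisForm_univ_ne_zero (hV : Module.finrank ℝ V = 6) {w : ⋀[ℝ]^6 V}
    (hw : w ≠ 0) : topPairing V (basisForm Finset.univ) w ≠ 0 := by
  intro h0
  have hall : ((topPairing V).flip w) = 0 := by
    refine eq_zero_of_basisForm fun I => ?_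
    by_cases hI : I = Finset.univ
    · rw [hI]
      exact h0
    · rw [LinearMap.flip_apply, basisForm, topPairing_eq_zero (basisWord_mem _), LinearMap.zero_apply]
      rw [Finset.length_toList]
      intro hc
      exact hI (Finset.eq_univ_of_card I (by rw [hc, Fintype.card_fin, hV]))
  have h1 : Module.finrank ℝ (⋀[ℝ]^6 V) = 1 := by
    rw [exteriorPower.finrank_eq, hV]
    rfl
  let b := Module.finBasisOfFinrankEq ℝ V hV
  obtain ⟨a, ha⟩ := exists_smul_eq_of_finrank_eq_one h1 hw (exteriorPower.ιMulti ℝ 6 b)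
  have e1 := exteriorPower.pairingDual_ιMulti_ιMulti (R := ℝ) b.coord b
  have e2 : (Matrix.of fun i j => b.coord j (b i)) = (1 : Matrix (Fin 6) (Fin 6) ℝ) := by
    ext i j
    simp [Matrix.one_apply, Finsupp.single_apply]
  rw [e2, Matrix.det_one, ← ha, map_smul, ← topPairing_of_mem, ← LinearMap.flip_apply, hall] at e1
  simp at e1

end Exterior

/-! ### The Clifford module `Λ*V* ⊗ L` -/

section Twisted

variable {V L : Type*} [AddCommGroup V] [Module ℝ V] [AddCommGroup L] [Module ℝ L]

theorem twClifford_tmul (x : Gen V) (l : L) (φ : Forms V) :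
    twClifford V L x (l ⊗ₜ φ) = l ⊗ₜ clifford V x φ := rfl

theorem twForm_tmul (sq : L ⊗[ℝ] L ≃ₗ[ℝ] ⋀[ℝ]^6 V) (l l' : L) (φ ψ : Forms V) :
    twForm sq (l ⊗ₜ φ) (l' ⊗ₜ ψ) = topPairing V (sigmaWedge V φ ψ) (sq (l ⊗ₜ l')) := rfl

theorem exists_eq_tmul {l : L} (hL : ∀ l', ∃ a : ℝ, a • l = l') (φ : TwForms V L) :
    ∃ φ', φ = l ⊗ₜ φ' := by
  induction φ using TensorProduct.induction_on with
  | zero => exact ⟨0, by simp⟩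
  | tmul l' φ =>
    obtain ⟨a, rfl⟩ := hL l'
    exact ⟨a • φ, by rw [TensorProduct.smul_tmul]⟩
  | add x y hx hy =>
    obtain ⟨φ, rfl⟩ := hx
    obtain ⟨ψ, rfl⟩ := hy
    exact ⟨φ + ψ, by rw [TensorProduct.tmul_add]⟩

variable [FiniteDimensional ℝ V]

theorem isCliffordModule_twForm (hV : Module.finrank ℝ V = 6) {l : L}
    (hL : ∀ l', ∃ a : ℝ, a • l = l') (sq : L ⊗[ℝ] L ≃ₗ[ℝ] ⋀[ℝ]^6 V) :
    IsCliffordModule (twClifford V L) (twForm sq) where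
  anticomm x y := twClifford_anticomm V L x y
  adj x φ ψ := by
    obtain ⟨φ, rfl⟩ := exists_eq_tmul hL φ
    obtain ⟨ψ, rfl⟩ := exists_eq_tmul hL ψ
    rw [twClifford_tmul, twClifford_tmul, twForm_tmul, twForm_tmul, topPairing_clifford hV]
  alt φ := by
    obtain ⟨φ, rfl⟩ := exists_eq_tmul hL φ
    rw [twForm_tmul, topPairing_sigmaWedge_self, LinearMap.zero_apply]

theorem isFockFamily_tmul (l : L) :
    IsFockFamily (twClifford V L) (fun I => l ⊗ₜ[ℝ] basisForm (V := V) I) where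
  create_of_mem i I hi := by
    rw [twClifford_tmul, isFockFamily_basisForm.create_of_mem i I hi, TensorProduct.tmul_zero]
  annihilate_of_notMem i I hi := by
    rw [twClifford_tmul, isFockFamily_basisForm.annihilate_of_notMem i I hi,
      TensorProduct.tmul_zero]
  create_of_notMem i I hi := by
    obtain ⟨s, hs, e⟩ := isFockFamily_basisForm.create_of_notMem i I hi
    exact ⟨s, hs, by rw [twClifford_tmul, e, TensorProduct.tmul_smul]⟩

theorem spinorSubmodule_eq_fockSpan (hV : Module.finrank ℝ V = 6) {l : L}
    (hL : ∀ l', ∃ a : ℝ, a • l = l') (sq : L ⊗[ℝ] L ≃ₗ[ℝ] ⋀[ℝ]^6 V) :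
    spinorSubmodule V L = fockSpan (fun I => l ⊗ₜ[ℝ] basisForm (V := V) I) 0 := by
  refine le_antisymm ?_ (fockSpan_le fun I hI => ?_)
  · rintro _ ⟨z, rfl⟩
    induction z using TensorProduct.induction_on with
    | zero => simp
    | add x y hx hy =>
      rw [map_add]
      exact Submodule.add_mem _ hx hy
    | tmul l' φ =>
      obtain ⟨a, rfl⟩ := hL l'
      obtain ⟨φ, hφ⟩ := φ
      rw [← TensorProduct.smul_tmul', map_smul]
      refine Submodule.smul_mem _ _ ?_
      rw [LinearMap.lTensor_tmul, Submodule.coe_subtype]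
      refine CliffordAlgebra.even_induction (0 : QuadraticForm ℝ (Module.Dual ℝ V))
        (motive := fun φ _ => l ⊗ₜ[ℝ] φ ∈ fockSpan (fun I => l ⊗ₜ[ℝ] basisForm (V := V) I) 0)
        (fun r => ?_) (fun x y _ _ hx hy => ?_) (fun ξ η x _ hx => ?_) φ hφ
      · have e : l ⊗ₜ[ℝ] basisForm (V := V) ∅ ∈
            fockSpan (fun I => l ⊗ₜ[ℝ] basisForm (V := V) I) 0 := by
          simpa using mem_fockSpan (fun I => l ⊗ₜ[ℝ] basisForm (V := V) I) ∅
        rw [Algebra.algebraMap_eq_smul_one, TensorProduct.tmul_smul]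
        refine Submodule.smul_mem _ _ ?_
        simpa [basisForm, basisWord] using e
      · rw [TensorProduct.tmul_add]
        exact Submodule.add_mem _ hx hy
      · have e := (isFockFamily_tmul l).clifford_mem (isCliffordModule_twForm hV hL sq) (0, ξ)
          ((isFockFamily_tmul l).clifford_mem (isCliffordModule_twForm hV hL sq) (0, η) hx)
        rw [add_assoc, CharTwo.add_self_eq_zero, add_zero, twClifford_tmul, twClifford_tmul,
          clifford_inr, clifford_inr, ← mul_assoc] at e
        exact e
  · refine ⟨l ⊗ₜ ⟨basisForm I, ?_⟩, rfl⟩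
    have := basisWord_mem_evenOdd I.toList
    rwa [Finset.length_toList, hI] at this

theorem exists_line_generator (hV : Module.finrank ℝ V = 6)
    (sq : L ⊗[ℝ] L ≃ₗ[ℝ] ⋀[ℝ]^6 V) : ∃ l : L, l ≠ 0 ∧ ∀ l', ∃ a : ℝ, a • l = l' := by
  have h1 : Module.finrank ℝ (⋀[ℝ]^6 V) = 1 := by
    rw [exteriorPower.finrank_eq, hV]
    rfl
  rw [← sq.finrank_eq, Module.finrank_tensorProduct] at h1
  exact finrank_eq_one_iff'.1 (Nat.eq_one_of_mul_eq_one_right h1)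

/-- The spinor module of a six-dimensional space satisfies the Fierz identity. -/
theorem isFierzModule_spinor (hV : Module.finrank ℝ V = 6) (sq : L ⊗[ℝ] L ≃ₗ[ℝ] ⋀[ℝ]^6 V) :
    ∃ S' : Submodule ℝ (TwForms V L),
      IsFierzModule (twClifford V L) (twForm sq) (spinorSubmodule V L) S' := by
  obtain ⟨l, -, hL⟩ := exists_line_generator hV sq
  rw [spinorSubmodule_eq_fockSpan hV hL sq]
  exact ⟨_, (isFockFamily_tmul l).isFierzModule hV (isCliffordModule_twForm hV hL sq)⟩

theorem eq_zero_of_twForm_eq_zero (hV : Module.finrank ℝ V = 6)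
    (sq : L ⊗[ℝ] L ≃ₗ[ℝ] ⋀[ℝ]^6 V) {φ : TwForms V L} (hφ : φ ∈ spinorSubmodule V L)
    (h0 : ∀ ψ ∈ spinorSubmodule V L, twForm sq φ ψ = 0) : φ = 0 := by
  obtain ⟨l, hl, hL⟩ := exists_line_generator hV sq
  rw [spinorSubmodule_eq_fockSpan hV hL sq] at hφ h0
  refine (isFockFamily_tmul l).eq_zero_of_form_eq_zero (isCliffordModule_twForm hV hL sq) ?_
    (hV ▸ by decide) hφ h0
  have e : basisForm (V := V) ∅ = 1 := by simp [basisForm, basisWord]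
  rw [twForm_tmul, sigmaWedge_apply, e, CliffordAlgebra.reverse.map_one, one_mul]
  refine topPairing_basisForm_univ_ne_zero hV ?_
  rw [Ne, LinearEquiv.map_eq_zero_iff]
  intro hc
  -- To see l ⊗ l ≠ 0, tensor the injection 1 ↦ l of ℝ into L with L; by flatness it stays
  -- injective, and it sends 1 ⊗ l to l ⊗ l.
  have h1 := Module.Flat.rTensor_preserves_injective_linearMap (M := L)
    (LinearMap.toSpanSingleton ℝ L l) (LinearMap.ker_eq_bot.1
      (LinearMap.ker_toSpanSingleton ℝ hl))
  have h2 : LinearMap.rTensor L (LinearMap.toSpanSingleton ℝ L l) (1 ⊗ₜ l) = 0 := by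
    simpa using hc
  have h3 := h1 (h2.trans (map_zero _).symm)
  have h4 := congrArg (TensorProduct.lid ℝ L) h3
  simp at h4
  exact hl h4

end Twisted

/-! ### The moment map and the quartic -/

section Moment

variable {V L : Type*} [AddCommGroup V] [Module ℝ V] [AddCommGroup L] [Module ℝ L]

theorem spinForm_apply (sq : L ⊗[ℝ] L ≃ₗ[ℝ] ⋀[ℝ]^6 V) (φ ψ : Spinor V L) :
    spinForm sq φ ψ = twForm sq (φ : TwForms V L) ψ := rfl

variable [FiniteDimensional ℝ V]

theorem spinRep_eq_quantize (a : So V) :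
    spinRep V L a = quantize (twClifford V L) (a : Module.End ℝ (Gen V)) := by
  rw [quantize_apply, Fintype.sum_sum_type, ← Finset.sum_add_distrib]
  simp [spinRep, frame]

theorem traceForm_moment (sq : L ⊗[ℝ] L ≃ₗ[ℝ] ⋀[ℝ]^6 V) (ρ : Spinor V L) (a : So V) :
    LinearMap.trace ℝ (Gen V) ((moment sq ρ : Module.End ℝ (Gen V)) * (a : Module.End ℝ (Gen V)))
      = 1 / 2 * twForm sq (quantize (twClifford V L) (a : Module.End ℝ (Gen V)) ρ) ρ := by
  have e := LinearMap.BilinForm.apply_toDual_symm_apply (hB := traceForm_nondegenerate V)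
    (momentDual sq ρ) a
  rw [← spinRep_eq_quantize]
  exact e

/-- Pairing with the rotation in the plane of x and y reads off the matrix entry of μ(ρ), and the
spin action of that rotation is half the commutator of c(x) and c(y). -/
theorem moment_eq_current (hV : Module.finrank ℝ V = 6) (sq : L ⊗[ℝ] L ≃ₗ[ℝ] ⋀[ℝ]^6 V)
    (ρ : Spinor V L) : (moment sq ρ : Module.End ℝ (Gen V))
      = current (twClifford V L) (twForm sq) (ρ : TwForms V L) ρ := by
  obtain ⟨l, -, hL⟩ := exists_line_generator hV sq
  have h := isCliffordModule_twForm hV hL sq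
  refine LinearMap.ext fun x => pairing_ext fun y => ?_
  have e := traceForm_moment sq ρ ⟨rotation V x y, rotation_mem_So x y⟩
  rw [trace_mul_rotation, IsCliffordModule.quantize_rotation, pairing_comm x,
    (mem_So_iff _).1 (moment sq ρ).2 y x, pairing_comm y] at e
  simp only [LinearMap.smul_apply, LinearMap.sub_apply, Module.End.mul_apply, map_smul, map_sub,
    smul_eq_mul, h.adj _ _ (ρ : TwForms V L)] at e
  rw [h.skew (twClifford V L x (ρ : TwForms V L))] at e
  rw [pairing_current]
  linarith

/-- The defining identity of the moment map, taken at a = μ(ρ). -/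
theorem quartic_eq (hV : Module.finrank ℝ V = 6) (sq : L ⊗[ℝ] L ≃ₗ[ℝ] ⋀[ℝ]^6 V)
    (ρ : Spinor V L) :
    quartic sq ρ = cliffordQuartic (twClifford V L) (twForm sq) (ρ : TwForms V L) := by
  rw [quartic, traceForm_moment, moment_eq_current hV, cliffordQuartic, momentAction_apply]
  ring

theorem quartic_eq_volFun {sq : L ⊗[ℝ] L ≃ₗ[ℝ] ⋀[ℝ]^6 V} {ρ : Spinor V L}
    (hρ : ρ ∈ stableSet sq) : quartic sq ρ = -3 * volFun sq ρ ^ 2 := by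
  have : quartic sq ρ < 0 := hρ
  rw [volFun, Real.sq_sqrt (by linarith)]
  ring

theorem volFun_pos {sq : L ⊗[ℝ] L ≃ₗ[ℝ] ⋀[ℝ]^6 V} {ρ : Spinor V L} (hρ : ρ ∈ stableSet sq) :
    0 < volFun sq ρ := by
  have : quartic sq ρ < 0 := hρ
  exact Real.sqrt_pos.2 (by linarith)

/-- The spinor `ρ̂` conjugate to `ρ`. -/
def hat (hV : Module.finrank ℝ V = 6) (sq : L ⊗[ℝ] L ≃ₗ[ℝ] ⋀[ℝ]^6 V) (ρ : Spinor V L) :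
    Spinor V L :=
  ⟨hatSpinor (twClifford V L) (twForm sq) (volFun sq ρ) (ρ : TwForms V L),
    (isFierzModule_spinor hV sq).choose_spec.hatSpinor_mem ρ.2⟩

theorem hat_isConjugate (hV : Module.finrank ℝ V = 6) {sq : L ⊗[ℝ] L ≃ₗ[ℝ] ⋀[ℝ]^6 V}
    {ρ : Spinor V L} (hρ : ρ ∈ stableSet sq) :
    IsConjugate (twClifford V L) (ρ : TwForms V L) (hat hV sq ρ : TwForms V L)
      (genComplex (twClifford V L) (twForm sq) (volFun sq ρ) (ρ : TwForms V L)) := by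
  obtain ⟨S', h⟩ := isFierzModule_spinor hV sq
  exact h.isConjugate_hatSpinor ρ.2 (volFun_pos hρ).ne' (by
    rw [← quartic_eq hV, quartic_eq_volFun hρ])

theorem spinForm_alt (hV : Module.finrank ℝ V = 6) (sq : L ⊗[ℝ] L ≃ₗ[ℝ] ⋀[ℝ]^6 V)
    (φ : Spinor V L) : spinForm sq φ φ = 0 :=
  (isFierzModule_spinor hV sq).choose_spec.alt _

theorem spinForm_skew (hV : Module.finrank ℝ V = 6) (sq : L ⊗[ℝ] L ≃ₗ[ℝ] ⋀[ℝ]^6 V)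
    (φ ψ : Spinor V L) : spinForm sq φ ψ = -spinForm sq ψ φ :=
  (isFierzModule_spinor hV sq).choose_spec.skew _ _

theorem spinForm_nondegenerate (hV : Module.finrank ℝ V = 6)
    (sq : L ⊗[ℝ] L ≃ₗ[ℝ] ⋀[ℝ]^6 V) : (spinForm sq).Nondegenerate := by
  have key : ∀ φ : Spinor V L, (∀ ψ, spinForm sq φ ψ = 0) → φ = 0 := fun φ hφ =>
    Subtype.ext (eq_zero_of_twForm_eq_zero hV sq φ.2 fun ψ hψ => hφ ⟨ψ, hψ⟩)
  exact ⟨key, fun φ hφ => key φ fun ψ => by rw [spinForm_skew hV, hφ, neg_zero]⟩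

theorem spinForm_hat (hV : Module.finrank ℝ V = 6) {sq : L ⊗[ℝ] L ≃ₗ[ℝ] ⋀[ℝ]^6 V}
    {ρ : Spinor V L} (hρ : ρ ∈ stableSet sq) :
    spinForm sq ρ (hat hV sq ρ) = -2 * volFun sq ρ := by
  have hq : cliffordQuartic (twClifford V L) (twForm sq) (ρ : TwForms V L)
      = -3 * volFun sq ρ ^ 2 := by rw [← quartic_eq hV, quartic_eq_volFun hρ]
  rw [spinForm_skew hV, spinForm_apply, hat, IsFierzModule.form_hatSpinor (volFun_pos hρ).ne' hq]
  ring

/-- A spinor with a conjugate is stable, and the conjugate is determined by the volume. -/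
theorem IsConjugate.stable (hV : Module.finrank ℝ V = 6) {sq : L ⊗[ℝ] L ≃ₗ[ℝ] ⋀[ℝ]^6 V}
    {ρ η : Spinor V L} {k : Module.End ℝ (Gen V)}
    (hc : IsConjugate (twClifford V L) (ρ : TwForms V L) (η : TwForms V L) k) {f : ℝ} (hf : 0 < f)
    (hB : spinForm sq ρ η = -2 * f) :
    ρ ∈ stableSet sq ∧ volFun sq ρ = f ∧ hat hV sq ρ = η := by
  obtain ⟨S', h⟩ := isFierzModule_spinor hV sq
  rw [spinForm_apply] at hB
  have hb : twForm sq (ρ : TwForms V L) η ≠ 0 := by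
    rw [hB]
    linarith
  have e1 := hc.cliffordQuartic_eq h (by omega) ρ.2 hb
  have e2 := hc.momentAction_eq h (by omega) ρ.2 hb
  rw [← quartic_eq hV, hB] at e1
  have e3 : volFun sq ρ = f := by
    rw [volFun, e1]
    rw [show -(-3 * (-2 * f / 2) ^ 2) / 3 = f ^ 2 by ring, Real.sqrt_sq hf.le]
  refine ⟨?_, e3, Subtype.ext ?_⟩
  · change quartic sq ρ < 0
    rw [e1]
    nlinarith
  · change hatSpinor (twClifford V L) (twForm sq) (volFun sq ρ) (ρ : TwForms V L) = η
    rw [hatSpinor, e2, e3, hB, smul_smul]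
    rw [show -(4 / (3 * f)) * (3 / 8 * (-2 * f)) = 1 by field_simp; norm_num, one_smul]

end Moment

/-! ### Real and imaginary parts -/

section ComplexParts

variable {E : Type*} [AddCommGroup E] [Module ℝ E]

/-- The element `x + i y` of the complexification. -/
def cpair (x y : E) : ℂ ⊗[ℝ] E := (1 : ℂ) ⊗ₜ x + Complex.I ⊗ₜ y

variable (E) in
/-- The real part. -/
def rePart : ℂ ⊗[ℝ] E →ₗ[ℝ] E := (TensorProduct.lid ℝ E).toLinearMap ∘ₗ
  LinearMap.rTensor E Complex.reLm

variable (E) in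
/-- The imaginary part. -/
def imPart : ℂ ⊗[ℝ] E →ₗ[ℝ] E := (TensorProduct.lid ℝ E).toLinearMap ∘ₗ
  LinearMap.rTensor E Complex.imLm

theorem rePart_cpair (x y : E) : rePart E (cpair x y) = x := by simp [rePart, cpair]

theorem imPart_cpair (x y : E) : imPart E (cpair x y) = y := by simp [imPart, cpair]

theorem cpair_parts (z : ℂ ⊗[ℝ] E) : cpair (rePart E z) (imPart E z) = z := by
  induction z using TensorProduct.induction_on with
  | zero => simp [cpair]
  | tmul a x =>
    simp only [cpair, rePart, imPart, LinearMap.comp_apply, LinearMap.rTensor_tmul,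
      LinearEquiv.coe_coe, TensorProduct.lid_tmul, Complex.reLm_coe, Complex.imLm_coe]
    rw [← TensorProduct.smul_tmul, ← TensorProduct.smul_tmul, ← TensorProduct.add_tmul]
    congr 1
    apply Complex.ext <;> simp
  | add z w hz hw =>
    conv_rhs => rw [← hz, ← hw]
    simp only [cpair, map_add, TensorProduct.tmul_add]
    abel

theorem cpair_inj {x y x' y' : E} : cpair x y = cpair x' y' ↔ x = x' ∧ y = y' := by
  refine ⟨fun h => ⟨?_, ?_⟩, fun ⟨h, h'⟩ => by rw [h, h']⟩
  · simpa only [rePart_cpair] using congrArg (rePart E) h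
  · simpa only [imPart_cpair] using congrArg (imPart E) h

theorem cpair_zero : cpair (0 : E) 0 = 0 := by simp [cpair]

theorem add_cpair (x y x' y' : E) : cpair x y + cpair x' y' = cpair (x + x') (y + y') := by
  simp only [cpair, TensorProduct.tmul_add]
  abel

theorem smul_cpair (a : ℂ) (x y : E) :
    a • cpair x y = cpair (a.re • x - a.im • y) (a.re • y + a.im • x) := by
  have e1 : a • (1 : ℂ) = a.re • (1 : ℂ) + a.im • Complex.I := by apply Complex.ext <;> simp
  have e2 : a • Complex.I = a.re • Complex.I + (-a.im) • (1 : ℂ) := by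
    apply Complex.ext <;> simp
  rw [cpair, smul_add, TensorProduct.smul_tmul', TensorProduct.smul_tmul', cpair, e1, e2]
  simp only [sub_eq_add_neg, ← neg_smul, TensorProduct.tmul_add, ← TensorProduct.smul_tmul,
    TensorProduct.add_tmul]
  abel

end ComplexParts

/-! ### Pure spinors as conjugate pairs, and the circle action -/

section Pure

variable {V L : Type*} [AddCommGroup V] [Module ℝ V] [AddCommGroup L] [Module ℝ L]

theorem complexClifford_cpair (x y : Gen V) (φ ψ : TwForms V L) :
    complexClifford V L (cpair x y) (cpair φ ψ)
      = cpair (twClifford V L x φ - twClifford V L y ψ)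
        (twClifford V L x ψ + twClifford V L y φ) := by
  simp only [cpair, complexClifford, map_add, LinearMap.add_apply,
    LinearMap.liftBaseChange_tmul, LinearMap.comp_apply, LinearMap.smul_apply,
    LinearMap.baseChangeHom_apply, LinearMap.baseChange_tmul, one_smul,
    TensorProduct.smul_tmul', smul_eq_mul, mul_one, Complex.I_mul_I, TensorProduct.tmul_add,
    TensorProduct.tmul_sub, TensorProduct.neg_tmul]
  abel

theorem conjSpinor_cpair (φ ψ : Spinor V L) : conjSpinor (cpair φ ψ) = cpair φ (-ψ) := by
  simp [conjSpinor, cpair, TensorProduct.neg_tmul, TensorProduct.tmul_neg]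

theorem ofReal_eq_cpair (ρ : Spinor V L) : ofReal ρ = cpair ρ 0 := by
  simp [ofReal, cpair]

theorem subtype_baseChange_cpair (φ ψ : Spinor V L) :
    (spinorSubmodule V L).subtype.baseChange ℂ (cpair φ ψ)
      = cpair (φ : TwForms V L) (ψ : TwForms V L) := by
  simp [cpair]

theorem mem_annihilator_cpair (φ ψ : Spinor V L) (x y : Gen V) :
    cpair x y ∈ annihilator (cpair φ ψ) ↔
      twClifford V L x (φ : TwForms V L) = twClifford V L y (ψ : TwForms V L) ∧
      twClifford V L x (ψ : TwForms V L) = -twClifford V L y (φ : TwForms V L) := by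
  rw [annihilator, LinearMap.mem_ker, LinearMap.flip_apply, subtype_baseChange_cpair,
    complexClifford_cpair, ← cpair_zero, cpair_inj, sub_eq_zero, ← eq_neg_iff_add_eq_zero]

theorem annihilator_smul {a : ℂ} (ha : a ≠ 0) (φ : ℂ ⊗[ℝ] Spinor V L) :
    annihilator (a • φ) = annihilator φ := by
  ext x
  simp [annihilator, ha]

theorem isPure_smul {a : ℂ} (ha : a ≠ 0) (φ : ℂ ⊗[ℝ] Spinor V L) :
    IsPure (a • φ) ↔ IsPure φ := by
  rw [IsPure, annihilator_smul ha, IsPure]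

variable [FiniteDimensional ℝ V]

theorem finrank_annihilator (φ : ℂ ⊗[ℝ] Spinor V L) :
    Module.finrank ℝ ((annihilator φ).restrictScalars ℝ)
      = 2 * Module.finrank ℂ (annihilator φ) := by
  rw [← Complex.finrank_real_complex]
  exact (Module.finrank_mul_finrank ℝ ℂ (annihilator φ)).symm

theorem finrank_gen : Module.finrank ℝ (Gen V) = 2 * Module.finrank ℝ V := by
  rw [Module.finrank_prod, Subspace.dual_finrank_eq, two_mul]

theorem baseChange_spinForm_cpair (hV : Module.finrank ℝ V = 6)
    (sq : L ⊗[ℝ] L ≃ₗ[ℝ] ⋀[ℝ]^6 V) (φ ψ : Spinor V L) :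
    (spinForm sq).baseChange ℂ (cpair φ ψ) (conjSpinor (cpair φ ψ))
      = Complex.I * ((-2 * spinForm sq φ ψ : ℝ) : ℂ) := by
  rw [conjSpinor_cpair]
  simp only [cpair, map_add, LinearMap.add_apply, LinearMap.BilinForm.baseChange_tmul,
    spinForm_alt hV, map_neg, TensorProduct.tmul_neg]
  rw [spinForm_skew hV sq ψ φ]
  apply Complex.ext <;> simp
  ring

/-- Taking imaginary parts identifies the annihilator, as a real space, with V ⊕ V*: k gives
surjectivity, and a real annihilating vector would kill both ρ and η. -/
theorem isPure_cpair_of_isConjugate (hV : Module.finrank ℝ V = 6)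
    {sq : L ⊗[ℝ] L ≃ₗ[ℝ] ⋀[ℝ]^6 V} {ρ η : Spinor V L} {k : Module.End ℝ (Gen V)}
    (hc : IsConjugate (twClifford V L) (ρ : TwForms V L) (η : TwForms V L) k)
    (hB : spinForm sq ρ η ≠ 0) : IsPure (cpair ρ η) := by
  obtain ⟨S', h⟩ := isFierzModule_spinor hV sq
  let F : (annihilator (cpair ρ η)).restrictScalars ℝ →ₗ[ℝ] Gen V :=
    imPart (Gen V) ∘ₗ Submodule.subtype _
  have hF : Function.Bijective F := by
    refine ⟨?_, fun y => ?_⟩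
    · rw [← LinearMap.ker_eq_bot, LinearMap.ker_eq_bot']
      rintro ⟨z, hz⟩ hz0
      have hz1 : imPart (Gen V) z = 0 := hz0
      rw [Submodule.restrictScalars_mem, ← cpair_parts z, hz1, mem_annihilator_cpair] at hz
      simp only [map_zero, LinearMap.zero_apply, neg_zero] at hz
      ext1
      rw [Submodule.coe_zero, Submodule.coe_mk, ← cpair_parts z, hz1,
        h.eq_zero_of_form_ne_zero hB hz.1 hz.2, cpair_zero]
    · refine ⟨⟨cpair (k y) y, ?_⟩, imPart_cpair _ _⟩
      rw [Submodule.restrictScalars_mem, mem_annihilator_cpair]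
      exact ⟨hc.left y, hc.right y⟩
  have e := (LinearEquiv.ofBijective F hF).finrank_eq
  rw [finrank_annihilator, finrank_gen] at e
  exact Nat.eq_of_mul_eq_mul_left two_pos e

/-- Purity makes the injective imaginary part map bijective by dimension; k sends the imaginary part
of an annihilating vector to its real part. -/
theorem exists_isConjugate_of_isPure (hV : Module.finrank ℝ V = 6)
    {sq : L ⊗[ℝ] L ≃ₗ[ℝ] ⋀[ℝ]^6 V} {ρ η : Spinor V L} (hp : IsPure (cpair ρ η))
    (hB : spinForm sq ρ η ≠ 0) : ∃ k : Module.End ℝ (Gen V),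
      IsConjugate (twClifford V L) (ρ : TwForms V L) (η : TwForms V L) k := by
  obtain ⟨S', h⟩ := isFierzModule_spinor hV sq
  let F : (annihilator (cpair ρ η)).restrictScalars ℝ →ₗ[ℝ] Gen V :=
    imPart (Gen V) ∘ₗ Submodule.subtype _
  have hF : Function.Injective F := by
    rw [← LinearMap.ker_eq_bot, LinearMap.ker_eq_bot']
    rintro ⟨z, hz⟩ hz0
    have hz1 : imPart (Gen V) z = 0 := hz0
    rw [Submodule.restrictScalars_mem, ← cpair_parts z, hz1, mem_annihilator_cpair] at hz
    simp only [map_zero, LinearMap.zero_apply, neg_zero] at hz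
    ext1
    rw [Submodule.coe_zero, Submodule.coe_mk, ← cpair_parts z, hz1,
      h.eq_zero_of_form_ne_zero hB hz.1 hz.2, cpair_zero]
  have hdim : Module.finrank ℝ ((annihilator (cpair ρ η)).restrictScalars ℝ)
      = Module.finrank ℝ (Gen V) := by
    rw [finrank_annihilator, finrank_gen, hp]
  have : FiniteDimensional ℝ ((annihilator (cpair ρ η)).restrictScalars ℝ) :=
    Module.Finite.of_injective F hF
  let e := LinearEquiv.ofInjectiveOfFinrankEq F hF hdim
  have he : ∀ y, cpair (rePart (Gen V) (e.symm y)) y ∈ annihilator (cpair ρ η) := fun y => by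
    have h1 : imPart (Gen V) (e.symm y) = y := e.apply_symm_apply y
    have h2 := (e.symm y).2
    rw [Submodule.restrictScalars_mem, ← cpair_parts (e.symm y : ℂ ⊗[ℝ] Gen V), h1] at h2
    exact h2
  refine ⟨rePart (Gen V) ∘ₗ Submodule.subtype _ ∘ₗ e.symm.toLinearMap, fun y => ?_, fun y => ?_⟩
  · exact ((mem_annihilator_cpair _ _ _ _).1 (he y)).1
  · exact ((mem_annihilator_cpair _ _ _ _).1 (he y)).2

/-- The condition ⟨φ, φ̄⟩ = iφ(ρ) fixes both size and sign of the pairing of ρ with twice the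
imaginary part of φ, so that part can only be ρ̂. -/
theorem two_smul_eq_cpair_hat (hV : Module.finrank ℝ V = 6) {sq : L ⊗[ℝ] L ≃ₗ[ℝ] ⋀[ℝ]^6 V}
    {ρ : Spinor V L} (hρ : ρ ∈ stableSet sq) {φ : ℂ ⊗[ℝ] Spinor V L} (hφ : IsPureHalf sq ρ φ) :
    (2 : ℂ) • φ = cpair ρ (hat hV sq ρ) := by
  obtain ⟨hp, hre, him⟩ := hφ
  have hf := volFun_pos hρ
  obtain ⟨a, b, rfl⟩ : ∃ a b, φ = cpair a b := ⟨_, _, (cpair_parts φ).symm⟩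
  rw [ofReal_eq_cpair, conjSpinor_cpair, add_cpair, cpair_inj] at hre
  rw [baseChange_spinForm_cpair hV] at him
  have hB : -2 * spinForm sq a b = volFun sq ρ :=
    Complex.ofReal_injective (mul_left_cancel₀ Complex.I_ne_zero him)
  have e : (2 : ℂ) • cpair a b = cpair ρ ((2 : ℝ) • b) := by
    rw [smul_cpair, hre.1]
    simp [two_smul]
  have hB2 : spinForm sq ρ ((2 : ℝ) • b) = -2 * volFun sq ρ := by
    rw [← hB, hre.1, ← two_smul ℝ, map_smul, map_smul, LinearMap.smul_apply, smul_eq_mul, smul_eq_mul]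
    linarith
  rw [← isPure_smul two_ne_zero, e] at hp
  obtain ⟨k, hk⟩ := exists_isConjugate_of_isPure hV hp (sq := sq) (by rw [hB2]; linarith)
  rw [e, (hk.stable hV hf hB2).2.2]

theorem isPureHalf_of_isConjugate (hV : Module.finrank ℝ V = 6)
    {sq : L ⊗[ℝ] L ≃ₗ[ℝ] ⋀[ℝ]^6 V} {ρ η : Spinor V L} {k : Module.End ℝ (Gen V)}
    (hc : IsConjugate (twClifford V L) (ρ : TwForms V L) (η : TwForms V L) k) {f : ℝ} (hf : 0 < f)
    (hB : spinForm sq ρ η = -2 * f) : IsPureHalf sq ρ ((1 / 2 : ℂ) • cpair ρ η) := by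
  refine ⟨?_, ?_, ?_⟩
  · rw [isPure_smul (by norm_num)]
    exact isPure_cpair_of_isConjugate hV hc (sq := sq) (by rw [hB]; linarith)
  · rw [smul_cpair, conjSpinor_cpair, add_cpair, ofReal_eq_cpair, cpair_inj]
    norm_num
    rw [← add_smul]
    norm_num
  · rw [smul_cpair, baseChange_spinForm_cpair hV, (hc.stable hV hf hB).2.1]
    congr 2
    norm_num
    rw [hB]
    ring

theorem isPureHalf_hat (hV : Module.finrank ℝ V = 6) {sq : L ⊗[ℝ] L ≃ₗ[ℝ] ⋀[ℝ]^6 V}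
    {ρ : Spinor V L} (hρ : ρ ∈ stableSet sq) :
    IsPureHalf sq ρ ((1 / 2 : ℂ) • cpair ρ (hat hV sq ρ)) :=
  isPureHalf_of_isConjugate hV (hat_isConjugate hV hρ) (volFun_pos hρ) (spinForm_hat hV hρ)

theorem existsUnique_isPureHalf (hV : Module.finrank ℝ V = 6) {sq : L ⊗[ℝ] L ≃ₗ[ℝ] ⋀[ℝ]^6 V}
    {ρ : Spinor V L} (hρ : ρ ∈ stableSet sq) : ∃! φ, IsPureHalf sq ρ φ := by
  refine ⟨_, isPureHalf_hat hV hρ, fun φ hφ => ?_⟩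
  rw [← two_smul_eq_cpair_hat hV hρ hφ, smul_smul]
  norm_num

/-- The circle action on stable spinors. -/
def rotate (hV : Module.finrank ℝ V = 6) (sq : L ⊗[ℝ] L ≃ₗ[ℝ] ⋀[ℝ]^6 V) (θ : ℝ)
    (ρ : Spinor V L) : Spinor V L :=
  Real.cos θ • ρ + Real.sin θ • hat hV sq ρ

/-- A phase does not change the annihilator, so the same K serves. The two spinors are the real and
imaginary parts of e^{-iθ}(ρ + iρ̂). -/
theorem rotate_isConjugate (hV : Module.finrank ℝ V = 6) {sq : L ⊗[ℝ] L ≃ₗ[ℝ] ⋀[ℝ]^6 V}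
    {ρ : Spinor V L} (hρ : ρ ∈ stableSet sq) (θ : ℝ) :
    IsConjugate (twClifford V L) (rotate hV sq θ ρ : TwForms V L)
      ((Real.cos θ • hat hV sq ρ - Real.sin θ • ρ : Spinor V L) : TwForms V L)
      (genComplex (twClifford V L) (twForm sq) (volFun sq ρ) (ρ : TwForms V L)) := by
  have hc := hat_isConjugate hV hρ
  constructor <;> intro x <;>
    simp only [rotate, Submodule.coe_add, Submodule.coe_sub, Submodule.coe_smul, map_add, map_sub,
      map_smul, hc.left, hc.right] <;> module

theorem spinForm_rotate (hV : Module.finrank ℝ V = 6) {sq : L ⊗[ℝ] L ≃ₗ[ℝ] ⋀[ℝ]^6 V}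
    {ρ : Spinor V L} (hρ : ρ ∈ stableSet sq) (θ : ℝ) :
    spinForm sq (rotate hV sq θ ρ) (Real.cos θ • hat hV sq ρ - Real.sin θ • ρ)
      = -2 * volFun sq ρ := by
  simp only [rotate, map_add, map_sub, map_smul, LinearMap.add_apply, LinearMap.smul_apply,
    smul_eq_mul, spinForm_alt hV]
  rw [spinForm_skew hV sq (hat hV sq ρ), spinForm_hat hV hρ]
  linear_combination (-2 * volFun sq ρ) * Real.cos_sq_add_sin_sq θ

theorem rotate_mem_stableSet (hV : Module.finrank ℝ V = 6) {sq : L ⊗[ℝ] L ≃ₗ[ℝ] ⋀[ℝ]^6 V}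
    {ρ : Spinor V L} (hρ : ρ ∈ stableSet sq) (θ : ℝ) : rotate hV sq θ ρ ∈ stableSet sq :=
  ((rotate_isConjugate hV hρ θ).stable hV (volFun_pos hρ) (spinForm_rotate hV hρ θ)).1

theorem hat_rotate (hV : Module.finrank ℝ V = 6) {sq : L ⊗[ℝ] L ≃ₗ[ℝ] ⋀[ℝ]^6 V}
    {ρ : Spinor V L} (hρ : ρ ∈ stableSet sq) (θ : ℝ) :
    hat hV sq (rotate hV sq θ ρ) = Real.cos θ • hat hV sq ρ - Real.sin θ • ρ :=
  ((rotate_isConjugate hV hρ θ).stable hV (volFun_pos hρ) (spinForm_rotate hV hρ θ)).2.2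

theorem isPureHalf_rotate (hV : Module.finrank ℝ V = 6) {sq : L ⊗[ℝ] L ≃ₗ[ℝ] ⋀[ℝ]^6 V}
    {ρ : Spinor V L} (hρ : ρ ∈ stableSet sq) {φ : ℂ ⊗[ℝ] Spinor V L} (hφ : IsPureHalf sq ρ φ)
    (θ : ℝ) : IsPureHalf sq (rotate hV sq θ ρ) (Complex.exp (-(Complex.I * θ)) • φ) := by
  have e1 : φ = (1 / 2 : ℂ) • cpair ρ (hat hV sq ρ) := by
    rw [← two_smul_eq_cpair_hat hV hρ hφ, smul_smul]
    norm_num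
  have e2 : Complex.exp (-(Complex.I * θ)) • cpair ρ (hat hV sq ρ)
      = cpair (rotate hV sq θ ρ) (hat hV sq (rotate hV sq θ ρ)) := by
    have e3 : Complex.exp (-(Complex.I * θ)) = ⟨Real.cos θ, -Real.sin θ⟩ := by
      rw [show -(Complex.I * θ) = ((-θ : ℝ) : ℂ) * Complex.I by push_cast; ring,
        Complex.exp_mul_I]
      apply Complex.ext <;> simp [← Complex.ofReal_cos, ← Complex.ofReal_sin]
    rw [smul_cpair, hat_rotate hV hρ, cpair_inj, e3, rotate]
    constructor <;> module
  rw [e1, smul_comm, e2]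
  exact isPureHalf_hat hV (rotate_mem_stableSet hV hρ θ)

end Pure

/-! ### Integrability of the derivative of a vector field -/

section Integrability

variable {E : Type*} [NormedAddCommGroup E] [NormedSpace ℝ E]

/-- A real vector space with an endomorphism of square `-1` has complex coordinates. -/
theorem exists_complex_coordinates [FiniteDimensional ℝ E] (J : E →ₗ[ℝ] E)
    (hJ : ∀ v, J (J v) = -v) :
    ∃ (n : ℕ) (P : E ≃ₗ[ℝ] EuclideanSpace ℂ (Fin n)), ∀ v, P (J v) = Complex.I • P v := by
  have hJ2 : (J : Module.End ℝ E) * J = -1 := LinearMap.ext hJ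
  let A : ℂ →ₐ[ℝ] Module.End ℝ E := Complex.lift ⟨J, hJ2⟩
  let _ : Module ℂ E := Module.compHom E A.toRingHom
  have hs : ∀ (z : ℂ) (v : E), z • v = A z v := fun _ _ => rfl
  have : IsScalarTower ℝ ℂ E := ⟨fun r z v => by
    rw [hs, hs, map_smul, LinearMap.smul_apply]⟩
  have : FiniteDimensional ℂ E := FiniteDimensional.right ℝ ℂ E
  refine ⟨Module.finrank ℂ E, ((Module.finBasis ℂ E).equivFun ≪≫ₗ
    (WithLp.linearEquiv 2 ℂ _).symm).restrictScalars ℝ, fun v => ?_⟩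
  have hI : J v = Complex.I • v := by
    rw [hs, show A Complex.I = J from Complex.liftAux_apply_I J hJ2]
  rw [hI, LinearEquiv.restrictScalars_apply, LinearEquiv.restrictScalars_apply, map_smul]

/-- If the derivative `J` of a vector field has square `-1`, then it is integrable: the map
`(1 - J₀ ∘ X) / 2` gives holomorphic coordinates near a point where `J = J₀`. -/
theorem isIntegrable_fderiv [FiniteDimensional ℝ E] {X : E → E} {U : Set E} (hU : IsOpen U)
    (hX : ContDiffOn ℝ ∞ X U) (hJ : ∀ x ∈ U, ∀ v, fderiv ℝ X x (fderiv ℝ X x v) = -v) :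
    IsIntegrable (fun x => fderiv ℝ X x) U := by
  intro x hx
  set J₀ := fderiv ℝ X x with hJ₀
  obtain ⟨n, P, hP⟩ := exists_complex_coordinates (J₀ : E →ₗ[ℝ] E) (hJ x hx)
  replace hP : ∀ v, P (J₀ v) = Complex.I • P v := hP
  let P' : E ≃L[ℝ] EuclideanSpace ℂ (Fin n) := P.toContinuousLinearEquiv
  let g : E → EuclideanSpace ℂ (Fin n) := fun y => P' ((1 / 2 : ℝ) • (y - J₀ (X y)))
  have hg : ContDiffOn ℝ ∞ g U := P'.contDiff.comp_contDiffOn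
    ((contDiffOn_id.sub (J₀.contDiff.comp_contDiffOn hX)).const_smul _)
  have hXd : ∀ y ∈ U, HasFDerivAt X (fderiv ℝ X y) y := fun y hy =>
    ((hX.contDiffAt (hU.mem_nhds hy)).differentiableAt (by simp)).hasFDerivAt
  have hg' : ∀ y ∈ U, HasFDerivAt g ((P' : E →L[ℝ] EuclideanSpace ℂ (Fin n)).comp
      ((1 / 2 : ℝ) • (ContinuousLinearMap.id ℝ E - J₀.comp (fderiv ℝ X y)))) y := fun y hy =>
    (P' : E →L[ℝ] EuclideanSpace ℂ (Fin n)).hasFDerivAt.comp y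
      (((hasFDerivAt_id y).sub (J₀.hasFDerivAt.comp y (hXd y hy))).const_smul (1 / 2 : ℝ))
  have hgx : HasFDerivAt g (P' : E →L[ℝ] EuclideanSpace ℂ (Fin n)) x := by
    convert hg' x hx using 1
    ext1 v
    have e : (1 / 2 : ℝ) • (v - J₀ (J₀ v)) = v := by
      rw [hJ x hx v]
      module
    simp only [ContinuousLinearMap.comp_apply, smul_apply,
      sub_apply, ContinuousLinearMap.id_apply]
    rw [← hJ₀, e]
  have hgc : ContDiffAt ℝ ∞ g x := hg.contDiffAt (hU.mem_nhds hx)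
  let z₀ := hgc.toOpenPartialHomeomorph g hgx (by simp)
  -- Restricting to points with invertible derivative makes the inverse chart smooth on the whole
  -- target, not only near the image of x.
  let W : Set E := U ∩ fderiv ℝ g ⁻¹'
    Set.range ((↑) : (E ≃L[ℝ] EuclideanSpace ℂ (Fin n)) → E →L[ℝ] EuclideanSpace ℂ (Fin n))
  have hW : IsOpen W := (hg.continuousOn_fderiv_of_isOpen hU (by simp)).isOpen_inter_preimage hU
    ContinuousLinearEquiv.isOpen
  have hxW : x ∈ W := ⟨hx, P', hgx.fderiv.symm⟩
  let z := z₀.restrOpen W hW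
  have hzs : z.source ⊆ W := Set.inter_subset_right
  refine ⟨n, z, ⟨hgc.mem_toOpenPartialHomeomorph_source hgx (by simp), hxW⟩,
    fun y hy => (hzs hy).1, hg.mono fun y hy => (hzs hy).1, fun w hw => ?_, fun y hy v => ?_⟩
  · have hm := z.map_target hw
    obtain ⟨hyU, Q, hQ⟩ := hzs hm
    refine (z.contDiffAt_symm (f₀' := Q) hw ?_ (hg.contDiffAt (hU.mem_nhds hyU))).contDiffWithinAt
    rw [hQ]
    exact ((hg.contDiffAt (hU.mem_nhds hyU)).differentiableAt (by simp)).hasFDerivAt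
  · have hyU : y ∈ U := (hzs hy).1
    have e : fderiv ℝ z y = _ := (hg' y hyU).fderiv
    rw [e]
    simp only [ContinuousLinearMap.comp_apply, smul_apply,
      sub_apply, ContinuousLinearMap.id_apply, hJ y hyU]
    change P _ = Complex.I • P _
    rw [← hP]
    -- What remains is (J - J₀J²)/2 = (J + J₀)/2 = J₀(1 - J₀J)/2, using both J² = -1 and J₀² = -1.
    congr 1
    simp only [map_smul, map_sub, map_neg]
    rw [hJ x hx]
    module

end Integrability

/-! ### Calculus of trilinear maps -/

section Trilinear

variable {E : Type*} [NormedAddCommGroup E] [NormedSpace ℝ E] [FiniteDimensional ℝ E]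
  (τ : E →ₗ[ℝ] E →ₗ[ℝ] E →ₗ[ℝ] E)

/-- A trilinear map of finite-dimensional spaces as an iterated continuous linear map. -/
def continuousTrilinear : E →L[ℝ] E →L[ℝ] E →L[ℝ] E :=
  (τ.compr₂ (LinearMap.toContinuousLinearMap (𝕜 := ℝ) (E := E) (F' := E)).toLinearMap).toContinuousBilinearMap

theorem continuousTrilinear_apply (x y z : E) : continuousTrilinear τ x y z = τ x y z := rfl

theorem contDiff_cubic : ContDiff ℝ ∞ fun x => τ x x x :=
  ((((continuousTrilinear τ).contDiff).clm_apply contDiff_id).clm_apply contDiff_id :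
    ContDiff ℝ ∞ fun x => continuousTrilinear τ x x x)

theorem fderiv_cubic (x v : E) :
    fderiv ℝ (fun x => τ x x x) x v = τ v x x + τ x v x + τ x x v := by
  have h := ((((continuousTrilinear τ).hasFDerivAt (x := x)).clm_apply (hasFDerivAt_id x)).clm_apply
    (hasFDerivAt_id x)).fderiv
  have h2 : fderiv ℝ (fun x => τ x x x) x = _ := h
  rw [h2]
  simp [continuousTrilinear_apply]
  abel

end Trilinear

/-! ### The Hamiltonian vector field of the volume -/

section Hamiltonian

variable {V L : Type*} [AddCommGroup V] [Module ℝ V] [FiniteDimensional ℝ V]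
  [AddCommGroup L] [Module ℝ L]

/-- The trilinear map `(ρ, ψ, χ) ↦ σ(μ(ρ, ψ))χ` on spinors. -/
def spinorAction (hV : Module.finrank ℝ V = 6) (sq : L ⊗[ℝ] L ≃ₗ[ℝ] ⋀[ℝ]^6 V) :
    Spinor V L →ₗ[ℝ] Spinor V L →ₗ[ℝ] Spinor V L →ₗ[ℝ] Spinor V L :=
  LinearMap.mk₂ ℝ
    (fun ρ ψ => (momentAction (twClifford V L) (twForm sq) (ρ : TwForms V L) ψ).restrict
      (p := spinorSubmodule V L) (q := spinorSubmodule V L)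
      fun _ hχ => (isFierzModule_spinor hV sq).choose_spec.quantize_mem _ hχ)
    (fun ρ ρ' ψ => LinearMap.ext fun χ => Subtype.ext (by simp; rfl))
    (fun a ρ ψ => LinearMap.ext fun χ => Subtype.ext (by simp; rfl))
    (fun ρ ψ ψ' => LinearMap.ext fun χ => Subtype.ext (by simp; rfl))
    (fun a ρ ψ => LinearMap.ext fun χ => Subtype.ext (by simp; rfl))

theorem coe_spinorAction (hV : Module.finrank ℝ V = 6) (sq : L ⊗[ℝ] L ≃ₗ[ℝ] ⋀[ℝ]^6 V)
    (ρ ψ χ : Spinor V L) : (spinorAction hV sq ρ ψ χ : TwForms V L)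
      = momentAction (twClifford V L) (twForm sq) (ρ : TwForms V L) ψ χ := rfl

theorem hat_eq (hV : Module.finrank ℝ V = 6) (sq : L ⊗[ℝ] L ≃ₗ[ℝ] ⋀[ℝ]^6 V) (ρ : Spinor V L) :
    hat hV sq ρ = (-(4 / 3) * (volFun sq ρ)⁻¹) • spinorAction hV sq ρ ρ ρ := by
  apply Subtype.ext
  change hatSpinor (twClifford V L) (twForm sq) (volFun sq ρ) (ρ : TwForms V L) = _
  rw [Submodule.coe_smul, coe_spinorAction, hatSpinor]
  congr 1
  rw [div_mul_eq_div_div, div_eq_mul_inv, neg_mul]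

theorem quartic_eq_spinForm (hV : Module.finrank ℝ V = 6) (sq : L ⊗[ℝ] L ≃ₗ[ℝ] ⋀[ℝ]^6 V)
    (ρ : Spinor V L) : quartic sq ρ = 2 * spinForm sq (spinorAction hV sq ρ ρ ρ) ρ :=
  quartic_eq hV sq ρ

theorem spinorAction_derivative (hV : Module.finrank ℝ V = 6) (sq : L ⊗[ℝ] L ≃ₗ[ℝ] ⋀[ℝ]^6 V)
    (ρ v : Spinor V L) :
    spinorAction hV sq v ρ ρ + spinorAction hV sq ρ v ρ + spinorAction hV sq ρ ρ v
      = (3 : ℝ) • spinorAction hV sq ρ ρ v + (3 / 4 * spinForm sq ρ v) • ρ := by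
  obtain ⟨S', h⟩ := isFierzModule_spinor hV sq
  have : Nontrivial V := Module.nontrivial_of_finrank_pos (R := ℝ) (by omega)
  have e : spinorAction hV sq ρ v ρ + spinorAction hV sq v ρ ρ
      = (2 : ℝ) • spinorAction hV sq ρ ρ v + (3 / 4 * spinForm sq ρ v) • ρ :=
    Subtype.ext (h.momentAction_add ρ.2 v.2)
  rw [add_comm (spinorAction hV sq v ρ ρ), e]
  module

theorem spinForm_spinorAction (hV : Module.finrank ℝ V = 6) (sq : L ⊗[ℝ] L ≃ₗ[ℝ] ⋀[ℝ]^6 V)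
    (ρ v : Spinor V L) :
    spinForm sq (spinorAction hV sq ρ ρ v) ρ = spinForm sq (spinorAction hV sq ρ ρ ρ) v := by
  obtain ⟨S', h⟩ := isFierzModule_spinor hV sq
  rw [spinForm_skew hV sq _ v, spinForm_apply, spinForm_apply, coe_spinorAction, coe_spinorAction,
    momentAction_apply, momentAction_apply]
  exact h.quantize_skew (h.current_self_mem_So _) _ _

variable [FiniteDimensional ℝ L]

/-- The symplectic form as a continuous bilinear map. -/
def continuousSpinForm (sq : L ⊗[ℝ] L ≃ₗ[ℝ] ⋀[ℝ]^6 V) :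
    Spinor V L →L[ℝ] Spinor V L →L[ℝ] ℝ :=
  (spinForm sq).toContinuousBilinearMap

theorem continuousSpinForm_apply (sq : L ⊗[ℝ] L ≃ₗ[ℝ] ⋀[ℝ]^6 V) (φ ψ : Spinor V L) :
    continuousSpinForm sq φ ψ = spinForm sq φ ψ := rfl

theorem quartic_eq_continuousSpinForm (hV : Module.finrank ℝ V = 6)
    (sq : L ⊗[ℝ] L ≃ₗ[ℝ] ⋀[ℝ]^6 V) : quartic sq
      = fun ρ : Spinor V L => 2 * continuousSpinForm sq (spinorAction hV sq ρ ρ ρ) ρ :=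
  funext (quartic_eq_spinForm hV sq)

theorem contDiff_quartic (hV : Module.finrank ℝ V = 6) (sq : L ⊗[ℝ] L ≃ₗ[ℝ] ⋀[ℝ]^6 V) :
    ContDiff ℝ ∞ (quartic sq) := by
  rw [quartic_eq_continuousSpinForm hV]
  exact contDiff_const.mul (((continuousSpinForm sq).contDiff.comp
    (contDiff_cubic (spinorAction hV sq))).clm_apply contDiff_id)

theorem isOpen_stableSet (hV : Module.finrank ℝ V = 6) (sq : L ⊗[ℝ] L ≃ₗ[ℝ] ⋀[ℝ]^6 V) :
    IsOpen (stableSet sq) :=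
  isOpen_lt (contDiff_quartic hV sq).continuous continuous_const

theorem hasFDerivAt_spinorAction (hV : Module.finrank ℝ V = 6) (sq : L ⊗[ℝ] L ≃ₗ[ℝ] ⋀[ℝ]^6 V)
    (ρ : Spinor V L) : HasFDerivAt (fun ρ => spinorAction hV sq ρ ρ ρ)
      (fderiv ℝ (fun ρ => spinorAction hV sq ρ ρ ρ) ρ) ρ :=
  ((contDiff_cubic (spinorAction hV sq)).differentiable (by simp) ρ).hasFDerivAt

/-- The cubic factor contributes three copies of ⟨σ(n)ρ, v⟩ by skewness of σ(n), the last slot one,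
and the remaining term contains ⟨ρ, ρ⟩ = 0; the total is 2 · 4. -/
theorem fderiv_quartic (hV : Module.finrank ℝ V = 6) (sq : L ⊗[ℝ] L ≃ₗ[ℝ] ⋀[ℝ]^6 V)
    (ρ v : Spinor V L) :
    fderiv ℝ (quartic sq) ρ v = 8 * spinForm sq (spinorAction hV sq ρ ρ ρ) v := by
  have h := ((((continuousSpinForm sq).hasFDerivAt.comp ρ
    (hasFDerivAt_spinorAction hV sq ρ)).clm_apply (hasFDerivAt_id ρ)).const_mul 2).fderiv
  have h2 : fderiv ℝ (quartic sq) ρ = _ :=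
    (congrArg (fderiv ℝ · ρ) (quartic_eq_continuousSpinForm hV sq)).trans h
  rw [h2]
  simp [continuousSpinForm_apply, fderiv_cubic, spinorAction_derivative, spinForm_alt hV,
    spinForm_spinorAction]
  ring

variable {sq : L ⊗[ℝ] L ≃ₗ[ℝ] ⋀[ℝ]^6 V}

/-- From dφ = -dq/(6φ) and the factor 8 above comes the constant -4/(3φ) in ρ̂. -/
theorem hasFDerivAt_volFun (hV : Module.finrank ℝ V = 6) {ρ : Spinor V L}
    (hρ : ρ ∈ stableSet sq) :
    HasFDerivAt (volFun sq) (continuousSpinForm sq (hat hV sq ρ)) ρ := by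
  have hq := ((contDiff_quartic hV sq).differentiable (by simp) ρ).hasFDerivAt
  have hρ' : quartic sq ρ < 0 := hρ
  have h := (hq.const_mul (-1 / 3 : ℝ)).sqrt (by linarith)
  have e : volFun sq = fun ρ => Real.sqrt (-1 / 3 * quartic sq ρ) := by
    funext ρ
    rw [volFun]
    congr 1
    ring
  rw [e]
  refine h.congr_fderiv (ContinuousLinearMap.ext fun v => ?_)
  rw [continuousSpinForm_apply, hat_eq, e]
  have h0 : Real.sqrt (-1 / 3 * quartic sq ρ) ≠ 0 := Real.sqrt_ne_zero'.2 (by linarith)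
  simp only [smul_apply, fderiv_quartic hV, map_smul, LinearMap.smul_apply, smul_eq_mul]
  field_simp
  ring

theorem contDiffOn_volFun (hV : Module.finrank ℝ V = 6) :
    ContDiffOn ℝ ∞ (volFun sq) (stableSet sq) :=
  ((contDiff_quartic hV sq).neg.div_const 3).contDiffOn.sqrt fun ρ hρ => by
    have hρ' : quartic sq ρ < 0 := hρ
    linarith

theorem contDiffOn_hat (hV : Module.finrank ℝ V = 6) :
    ContDiffOn ℝ ∞ (hat hV sq) (stableSet sq) :=
  ((contDiffOn_const.mul ((contDiffOn_volFun hV).inv fun _ hρ => (volFun_pos hρ).ne')).smul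
    (contDiff_cubic (spinorAction hV sq)).contDiffOn).congr fun ρ _ => hat_eq hV sq ρ

/-- Product rule: the derivative of 1/φ gives the term along ρ̂, the polarized Fierz identity gives
-σ(K)v and the term along ρ. -/
theorem coe_fderiv_hat (hV : Module.finrank ℝ V = 6) {ρ : Spinor V L} (hρ : ρ ∈ stableSet sq)
    (v : Spinor V L) : (fderiv ℝ (hat hV sq) ρ v : TwForms V L)
      = spinorComplex (twClifford V L) (twForm sq) (volFun sq ρ) (ρ : TwForms V L) v := by
  have hf := (volFun_pos hρ).ne'
  have h := ((((hasDerivAt_inv hf).comp_hasFDerivAt ρ (hasFDerivAt_volFun hV hρ)).const_mul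
    (-(4 / 3) : ℝ)).smul (hasFDerivAt_spinorAction hV sq ρ)).fderiv
  have h2 : fderiv ℝ (hat hV sq) ρ = _ :=
    (congrArg (fderiv ℝ · ρ) (funext (hat_eq hV sq))).trans h
  have e : fderiv ℝ (hat hV sq) ρ v
      = -((4 / volFun sq ρ) • spinorAction hV sq ρ ρ v) + (1 / volFun sq ρ) •
        (spinForm sq v (hat hV sq ρ) • hat hV sq ρ + spinForm sq v ρ • ρ) := by
    rw [h2, spinForm_skew hV sq v, spinForm_skew hV sq v]
    simp only [add_apply, smul_apply, ContinuousLinearMap.smulRight_apply,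
      fderiv_cubic, spinorAction_derivative, continuousSpinForm_apply, Function.comp_apply, smul_eq_mul]
    generalize spinForm sq (hat hV sq ρ) v = b
    rw [hat_eq]
    generalize volFun sq ρ = f at hf ⊢
    match_scalars <;> field_simp
  rw [e, spinorComplex, genComplex, map_smul]
  rfl

theorem fderiv_hat_fderiv_hat (hV : Module.finrank ℝ V = 6) {ρ : Spinor V L}
    (hρ : ρ ∈ stableSet sq) (v : Spinor V L) :
    fderiv ℝ (hat hV sq) ρ (fderiv ℝ (hat hV sq) ρ v) = -v := by
  obtain ⟨S', h⟩ := isFierzModule_spinor hV sq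
  have : Nontrivial V := Module.nontrivial_of_finrank_pos (R := ℝ) (by omega)
  apply Subtype.ext
  rw [coe_fderiv_hat hV hρ, coe_fderiv_hat hV hρ, Submodule.coe_neg]
  exact h.spinorComplex_spinorComplex ρ.2 (volFun_pos hρ).ne'
    (by rw [← quartic_eq hV, quartic_eq_volFun hρ]) v.2

theorem isHamiltonianVectorField_hat (hV : Module.finrank ℝ V = 6)
    (sq : L ⊗[ℝ] L ≃ₗ[ℝ] ⋀[ℝ]^6 V) :
    IsHamiltonianVectorField (spinForm sq) (volFun sq) (hat hV sq) (stableSet sq) :=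
  fun _ hρ => ⟨(hasFDerivAt_volFun hV hρ).differentiableAt, fun v => by
    rw [(hasFDerivAt_volFun hV hρ).fderiv, continuousSpinForm_apply]⟩

theorem IsHamiltonianVectorField.eqOn_hat (hV : Module.finrank ℝ V = 6)
    {X : Spinor V L → Spinor V L}
    (hX : IsHamiltonianVectorField (spinForm sq) (volFun sq) X (stableSet sq)) :
    Set.EqOn X (hat hV sq) (stableSet sq) := fun ρ hρ => by
  rw [← sub_eq_zero]
  refine (spinForm_nondegenerate hV sq).1 _ fun v => ?_
  rw [map_sub, LinearMap.sub_apply, (hX ρ hρ).2, (isHamiltonianVectorField_hat hV sq ρ hρ).2,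
    sub_self]

theorem hasDerivAt_rotate (hV : Module.finrank ℝ V = 6) {ρ : Spinor V L} (hρ : ρ ∈ stableSet sq)
    (θ : ℝ) : HasDerivAt (fun t => rotate hV sq t ρ) (hat hV sq (rotate hV sq θ ρ)) θ := by
  rw [hat_rotate hV hρ]
  refine (((Real.hasDerivAt_cos θ).smul_const ρ).add
    ((Real.hasDerivAt_sin θ).smul_const (hat hV sq ρ))).congr_deriv ?_
  module

end Hamiltonian

end SpinSix

end

theorem mainTheorem11 {V L : Type*} [AddCommGroup V] [Module ℝ V] [FiniteDimensional ℝ V]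
    [AddCommGroup L] [Module ℝ L] [FiniteDimensional ℝ L]
    (hV : Module.finrank ℝ V = 6) (sq : L ⊗[ℝ] L ≃ₗ[ℝ] ⋀[ℝ]^6 V) :
    IsOpen (SpinSix.stableSet sq) ∧
    (SpinSix.spinForm sq).IsAlt ∧ (SpinSix.spinForm sq).Nondegenerate ∧
    (∀ ρ ∈ SpinSix.stableSet sq, ∃! φ, SpinSix.IsPureHalf sq ρ φ) ∧
    (∃ X : SpinSix.Spinor V L → SpinSix.Spinor V L,
      SpinSix.IsHamiltonianVectorField (SpinSix.spinForm sq) (SpinSix.volFun sq) X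
        (SpinSix.stableSet sq)) ∧
    ∀ X : SpinSix.Spinor V L → SpinSix.Spinor V L,
      SpinSix.IsHamiltonianVectorField (SpinSix.spinForm sq) (SpinSix.volFun sq) X
        (SpinSix.stableSet sq) →
      (∀ ρ ∈ SpinSix.stableSet sq, ∀ φ, SpinSix.IsPureHalf sq ρ φ →
        SpinSix.ofReal ρ + Complex.I • SpinSix.ofReal (X ρ) = (2 : ℂ) • φ) ∧
      (∃ Φ : ℝ → SpinSix.Spinor V L → SpinSix.Spinor V L,
        (∀ ρ ∈ SpinSix.stableSet sq, ∀ φ, SpinSix.IsPureHalf sq ρ φ → ∀ θ : ℝ,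
          Φ θ ρ ∈ SpinSix.stableSet sq ∧
            SpinSix.IsPureHalf sq (Φ θ ρ) (Complex.exp (-(Complex.I * θ)) • φ)) ∧
        ∀ ρ ∈ SpinSix.stableSet sq, ∀ θ : ℝ,
          HasDerivAt (fun t : ℝ => Φ t ρ) (X (Φ θ ρ)) θ) ∧
      (ContDiffOn ℝ ∞ X (SpinSix.stableSet sq) ∧
        SpinSix.IsAlmostComplexStructure (fun ρ => fderiv ℝ X ρ) (SpinSix.stableSet sq) ∧
        SpinSix.IsIntegrable (fun ρ => fderiv ℝ X ρ) (SpinSix.stableSet sq)) := by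
  have hU := SpinSix.isOpen_stableSet hV sq
  refine ⟨hU, SpinSix.spinForm_alt hV sq, SpinSix.spinForm_nondegenerate hV sq,
    fun ρ hρ => SpinSix.existsUnique_isPureHalf hV hρ,
    ⟨_, SpinSix.isHamiltonianVectorField_hat hV sq⟩, fun X hX => ?_⟩
  have hXe := hX.eqOn_hat hV
  have hXs : ContDiffOn ℝ ∞ X (SpinSix.stableSet sq) := (SpinSix.contDiffOn_hat hV).congr hXe
  have hXJ : ∀ ρ ∈ SpinSix.stableSet sq, ∀ v, fderiv ℝ X ρ (fderiv ℝ X ρ v) = -v := by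
    intro ρ hρ v
    -- X agrees with ρ̂ only on U, but U is open, so the derivatives agree there as well.
    rw [(hXe.eventuallyEq_of_mem (hU.mem_nhds hρ)).fderiv_eq]
    exact SpinSix.fderiv_hat_fderiv_hat hV hρ v
  refine ⟨fun ρ hρ φ hφ => ?_, ⟨SpinSix.rotate hV sq, fun ρ hρ φ hφ θ =>
    ⟨SpinSix.rotate_mem_stableSet hV hρ θ, SpinSix.isPureHalf_rotate hV hρ hφ θ⟩,
    fun ρ hρ θ => ?_⟩, hXs, ⟨hXs.fderiv_of_isOpen hU (by simp), hXJ⟩,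
    SpinSix.isIntegrable_fderiv hU hXs hXJ⟩
  · rw [hXe hρ, SpinSix.two_smul_eq_cpair_hat hV hρ hφ, SpinSix.cpair, SpinSix.ofReal,
      SpinSix.ofReal, TensorProduct.smul_tmul', smul_eq_mul, mul_one]
  · rw [hXe (SpinSix.rotate_mem_stableSet hV hρ θ)]
    exact SpinSix.hasDerivAt_rotate hV hρ θ
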